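/- Let $(N,F)$ be a Finsler manifold: $N$ is a smooth real $n$-dimensional manifold and $F:TN\to[0,\infty)$ is smooth on $TN^0=TN\setminus 0(N)$, vanishes exactly on the zero section $0(N)$, is positively homogeneous of degree one on the fibres, and $[g_{bc}]=\big[\tfrac12\,\partial^2F^2/\partial y^b\partial y^c\big]$ is positive definite on $TN^0$ in the coordinates $(x^a,y^a)$ induced on $TN$ by any chart of $N$. Put $$G^a=\tfrac14 g^{ab}\Big(\frac{\partial^2F^2}{\partial y^b\partial x^c}y^c-\frac{\partial F^2}{\partial x^b}\Big),\quad G^a_b=\frac{\partial G^a}{\partial y^b},\quad \frac{\delta}{\delta x^a}=\frac{\partial}{\partial x^a}-G_a^b\frac{\partial}{\partial y^b},\quad \delta y^a=dy^a+G^a_b\,dx^b .$$ Let $V$ and $H$ be the projectors of $T(TN^0)$ onto the vertical distribution, spanned by the $\partial/\partial y^i$, and the horizontal distribution, spanned by the $\delta/\delta x^a$, along each other. Let $G$ be the Sasaki–Finsler metric on $TN^0$, given by $G(\frac{\delta}{\delta x^a},\frac{\delta}{\delta x^b})=G(\frac{\partial}{\partial y^a},\frac{\partial}{\partial y^b})=g_{ab}$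 and $G(\frac{\delta}{\delta x^a},\frac{\partial}{\partial y^b})=0$. Let $W$ be a Weyl structure on the conformal class of $G$, that is, a map from the metrics $e^uG$, $u\in C^\infty(TN^0)$, to the smooth one-forms on $TN^0$ with $W(e^uG)=W(G)-du$, and write $W(G)=\rho_a\,dx^a+\theta_i\,\delta y^i$, $\theta^i=g^{ij}\theta_j$, $\rho^a=g^{ab}\rho_b$. For a distribution with projector $Q$ and complementary projector $Q'$ (here $(Q,Q')=(V,H)$ or $(H,V)$), the intrinsic Weyl connection $\nabla^Q$ on $\operatorname{im}Q$ is given by $\nabla^Q_{Q'X}QY=Q[Q'X,QY]$ and, for sections $A,B,C$ of $\operatorname{im}Q$, by $$\begin{aligned}2G(\nabla^Q_AB,C)={}&A\,G(B,C)+B\,G(C,A)-C\,G(A,B)\\&+G(Q[A,B],C)-G(Q[B,C],A)+G(Q[C,A],B)\\&+W(G)(A)\,G(B,C)+W(G)(B)\,G(C,A)-W(G)(C)\,G(A,B).\end{aligned}$$ The Vranceanu connection of $(TN,G,W)$ is $\nabla^*_XY=\nabla^V_XVY+\nabla^H_XHY$. Let $L=y^i\frac{\partial}{\partial y^i}$ be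 the Liouville vector field and $L^*=y^a\frac{\delta}{\delta x^a}$ the geodesic spray. Then for every smooth vector field $X=X^i\frac{\partial}{\partial y^i}+X^a\frac{\delta}{\delta x^a}$ on $TN^0$ (the $X^i$ are its vertical and the $X^a$ its horizontal components), in the coordinates induced by any chart of $N$, $$\nabla^*_XL=\Big[X^i+\tfrac12X^jy^k\big(\theta_j\delta^i_k+\theta_k\delta^i_j-\theta^ig_{jk}\big)\Big]\frac{\partial}{\partial y^i},$$ $$\nabla^*_XL^*=\Big[X^i\delta^a_i+\tfrac12X^by^c\big(\rho_b\delta^a_c+\rho_c\delta^a_b-\rho^ag_{bc}\big)\Big]\frac{\delta}{\delta x^a}.$$ In particular, if $W(G)=\theta_F=\tfrac12\frac{\partial F^2}{\partial y^a}dx^a$ (the Cartan form), then $$\nabla^*_XL=X^i\frac{\partial}{\partial y^i},\qquad \nabla^*_XL^*=\Big(X^i\delta^a_i+\tfrac12X^ay^cy^ug_{uc}\Big)\frac{\delta}{\delta x^a},$$ that is, $\nabla^*_XL=VX$ and $\nabla^*_XL^*=\Theta(X)+\tfrac12F^2HX$, where $\Theta=\frac{\delta}{\delta x^i}\otimes\delta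 y^i$. -/

import Mathlib

open scoped Manifold ContDiff

noncomputable section

/-! ## Sub-Weyl geometry of a distribution on a manifold

`M` is a manifold, `g` a metric on it, `β` a one-form (the value `W(g)` of a Weyl structure at the
metric `g`), and a splitting `TM = D ⊕ D'` is given by its two projectors `Q`, `Q'`. All notions are
local, so everything may be given on an open subset `S` of `M` only, with irrelevant values
outside `S`. -/

namespace SubWeyl

variable {E : Type*} [NormedAddCommGroup E] [NormedSpace ℝ E]
  {H : Type*} [TopologicalSpace H] (I : ModelWithCorners ℝ E H)
  {M : Type*} [TopologicalSpace M] [ChartedSpace H M]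

/-- The differential `df`, as a one-form. -/
def diff (f : M → ℝ) (p : M) : TangentSpace I p →L[ℝ] ℝ := mfderiv I 𝓘(ℝ, ℝ) f p

/-- The derivative `X(f)` of a function along a vector field, at `p`. -/
def dirDeriv (X : Π p : M, TangentSpace I p) (f : M → ℝ) (p : M) : ℝ :=
  diff I f p (X p)

/-- `X` is smooth at `p`. -/
def SmoothFieldAt [IsManifold I 1 M] (X : Π p : M, TangentSpace I p) (p : M) : Prop :=
  ContMDiffAt I I.tangent ∞ (fun q => (⟨q, X q⟩ : TangentBundle I M)) p

/-- `X` is a smooth vector field on the open set `S`. -/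
def SmoothFieldOn [IsManifold I 1 M] (X : Π p : M, TangentSpace I p) (S : Set M) : Prop :=
  ContMDiffOn I I.tangent ∞ (fun q => (⟨q, X q⟩ : TangentBundle I M)) S

/-- `β` is a smooth one-form on the open set `S`. -/
def SmoothOneFormOn [IsManifold I 1 M] (β : Π p : M, TangentSpace I p →L[ℝ] ℝ)
    (S : Set M) : Prop :=
  ContMDiffOn I (I.prod 𝓘(ℝ, E →L[ℝ] ℝ)) ∞
    (fun q => Bundle.TotalSpace.mk' (E →L[ℝ] ℝ)
      (E := fun q : M => TangentSpace I q →L[ℝ] Bundle.Trivial M ℝ q) q (β q)) S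

/-- The conformally changed metric `e^u g`. -/
def conformal (u : M → ℝ) (g : Π p : M, TangentSpace I p → TangentSpace I p → ℝ) :
    Π p : M, TangentSpace I p → TangentSpace I p → ℝ :=
  fun p v w => Real.exp (u p) * g p v w

/-- `W` is a Weyl structure on the open set `S` for the conformal class of `g`: it assigns to every
metric `e^u g` of the class, `u` smooth on `S`, a smooth one-form on `S`, in such a way that
`W(e^u g) = W(g) - du`. -/
structure IsWeylStructureOn [IsManifold I 1 M]
    (g : Π p : M, TangentSpace I p → TangentSpace I p → ℝ)
    (W : (Π p : M, TangentSpace I p → TangentSpace I p → ℝ) → Π p : M, TangentSpace I p →L[ℝ] ℝ)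
    (S : Set M) : Prop where
  smooth : ∀ u : M → ℝ, ContMDiffOn I 𝓘(ℝ, ℝ) ∞ u S → SmoothOneFormOn I (W (conformal I u g)) S
  law : ∀ u : M → ℝ, ContMDiffOn I 𝓘(ℝ, ℝ) ∞ u S → ∀ p ∈ S, ∀ v : TangentSpace I p,
    W (conformal I u g) p v = W g p v - diff I u p v

/-- The right-hand side, at `p`, of the Koszul formula of Weyl geometry for three sections
`A`, `B`, `C` of `D`:
`A(g(B,C)) + B(g(C,A)) - C(g(A,B)) + g(Q[A,B],C) - g(Q[B,C],A) + g(Q[C,A],B)`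
`+ β(A)g(B,C) + β(B)g(C,A) - β(C)g(A,B)`. -/
def koszul (g : Π p : M, TangentSpace I p → TangentSpace I p → ℝ)
    (β : Π p : M, TangentSpace I p →L[ℝ] ℝ)
    (Q : Π p : M, TangentSpace I p →L[ℝ] TangentSpace I p)
    (A B C : Π p : M, TangentSpace I p) (p : M) : ℝ :=
  dirDeriv I A (fun q => g q (B q) (C q)) p
    + dirDeriv I B (fun q => g q (C q) (A q)) p
    - dirDeriv I C (fun q => g q (A q) (B q)) p
    + g p (Q p (VectorField.mlieBracket I A B p)) (C p)
    - g p (Q p (VectorField.mlieBracket I B C p)) (A p)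
    + g p (Q p (VectorField.mlieBracket I C A p)) (B p)
    + β p (A p) * g p (B p) (C p)
    + β p (B p) * g p (C p) (A p)
    - β p (C p) * g p (A p) (B p)

/-- `w` is the value at `p` of `∇_{QX} QY`: it lies in `D` and satisfies
`2 g(w, QZ) = koszul(QX, QY, QZ)` for every vector field `Z`. -/
def IsKoszulDerivAt [IsManifold I 1 M]
    (g : Π p : M, TangentSpace I p → TangentSpace I p → ℝ)
    (β : Π p : M, TangentSpace I p →L[ℝ] ℝ)
    (Q : Π p : M, TangentSpace I p →L[ℝ] TangentSpace I p)
    (X Y : Π p : M, TangentSpace I p) (p : M) (w : TangentSpace I p) : Prop :=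
  Q p w = w ∧ ∀ Z : (Π q : M, TangentSpace I q), SmoothFieldAt I Z p →
    2 * g p w (Q p (Z p)) =
      koszul I g β Q (fun q => Q q (X q)) (fun q => Q q (Y q)) (fun q => Q q (Z q)) p

/-- `∇_X QY` at `p`, for the intrinsic Weyl connection `∇` of the distribution `D = im Q` with
complement `D' = im Q'`: the connection on `D` with `∇_{QX} QY` given by the Koszul formula and
`∇_{Q'X} QY = Q[Q'X, QY]`. -/
def intrinsicWeyl [IsManifold I 1 M]
    (g : Π p : M, TangentSpace I p → TangentSpace I p → ℝ)
    (β : Π p : M, TangentSpace I p →L[ℝ] ℝ)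
    (Q Q' : Π p : M, TangentSpace I p →L[ℝ] TangentSpace I p)
    (X Y : Π p : M, TangentSpace I p) (p : M) : TangentSpace I p :=
  Classical.epsilon (fun w : TangentSpace I p => IsKoszulDerivAt I g β Q X Y p w)
    + Q p (VectorField.mlieBracket I (fun q => Q' q (X q)) (fun q => Q q (Y q)) p)

/-- The Vranceanu connection `∇*_X Y = ∇_X QY + ∇'_X Q'Y`, where `∇` and `∇'` are the intrinsic
Weyl connections of `D` and of `D'`. -/
def vranceanu [IsManifold I 1 M]
    (g : Π p : M, TangentSpace I p → TangentSpace I p → ℝ)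
    (β : Π p : M, TangentSpace I p →L[ℝ] ℝ)
    (Q Q' : Π p : M, TangentSpace I p →L[ℝ] TangentSpace I p)
    (X Y : Π p : M, TangentSpace I p) (p : M) : TangentSpace I p :=
  intrinsicWeyl I g β Q Q' X Y p + intrinsicWeyl I g β Q' Q X Y p

end SubWeyl

/-! ## The slit tangent bundle of a Finsler manifold -/

namespace Finsler

/-- The coordinate space `ℝⁿ`. -/
abbrev Coord (n : ℕ) : Type := EuclideanSpace ℝ (Fin n)

/-- The total space `TN`. -/
abbrev TB (n : ℕ) (N : Type*) [TopologicalSpace N] [ChartedSpace (Coord n) N] : Type _ :=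
  TangentBundle 𝓘(ℝ, Coord n) N

/-- The model of the manifold `TN`. -/
abbrev TI (n : ℕ) : ModelWithCorners ℝ (Coord n × Coord n) (ModelProd (Coord n) (Coord n)) :=
  (𝓘(ℝ, Coord n)).tangent

/-- The `a`-th vector of the standard basis of `ℝⁿ`. -/
def stdB {n : ℕ} (a : Fin n) : Coord n := EuclideanSpace.single a 1

/-- `∂f/∂x^a` for a function `f(x, y)` on `ℝⁿ × ℝⁿ`. -/
def pdx {n : ℕ} (a : Fin n) (f : Coord n × Coord n → ℝ) (z : Coord n × Coord n) : ℝ :=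
  fderiv ℝ f z (stdB a, 0)

/-- `∂f/∂y^a` for a function `f(x, y)` on `ℝⁿ × ℝⁿ`. -/
def pdy {n : ℕ} (a : Fin n) (f : Coord n × Coord n → ℝ) (z : Coord n × Coord n) : ℝ :=
  fderiv ℝ f z (0, stdB a)

section

variable {n : ℕ} {N : Type*} [TopologicalSpace N] [ChartedSpace (Coord n) N]
  [IsManifold 𝓘(ℝ, Coord n) ∞ N]

/-- `TN⁰`, the tangent bundle without its zero section. -/
def slit (n : ℕ) (N : Type*) [TopologicalSpace N] [ChartedSpace (Coord n) N] : Set (TB n N) :=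
  {p | p.2 ≠ 0}

/-- The coordinates `(x^a, y^a)` on `TN` induced by a chart `e` of `N`. -/
def coords (e : OpenPartialHomeomorph N (Coord n)) (p : TB n N) : Coord n × Coord n :=
  (e p.1, mfderiv 𝓘(ℝ, Coord n) 𝓘(ℝ, Coord n) e p.1 p.2)

/-- The point of `TN` with coordinates `(x, y)`, the inverse of `coords e`. -/
def point (e : OpenPartialHomeomorph N (Coord n)) (z : Coord n × Coord n) : TB n N :=
  ⟨e.symm z.1, mfderiv 𝓘(ℝ, Coord n) 𝓘(ℝ, Coord n) e.symm z.1 z.2⟩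

/-- `F²` in the coordinates `(x, y)`. -/
def sqF (F : TB n N → ℝ) (e : OpenPartialHomeomorph N (Coord n)) (z : Coord n × Coord n) : ℝ :=
  F (point e z) ^ 2

/-- The matrix `g_{bc} = ½ ∂²F²/∂y^b∂y^c`. -/
def gMat (F : TB n N → ℝ) (e : OpenPartialHomeomorph N (Coord n)) (z : Coord n × Coord n) :
    Matrix (Fin n) (Fin n) ℝ :=
  Matrix.of fun b c => (1 / 2 : ℝ) * pdy b (pdy c (sqF F e)) z

/-- `F` is a Finsler function on `N`. -/
structure IsFinsler (F : TB n N → ℝ) : Prop where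
  nonneg : ∀ p, 0 ≤ F p
  smooth : ContMDiffOn (TI n) 𝓘(ℝ, ℝ) ∞ F (slit n N)
  eq_zero_iff : ∀ p : TB n N, F p = 0 ↔ p.2 = 0
  homogeneous : ∀ (x : N) (v : TangentSpace 𝓘(ℝ, Coord n) x) (c : ℝ), 0 < c →
    F ⟨x, c • v⟩ = c * F ⟨x, v⟩
  posDef : ∀ e ∈ IsManifold.maximalAtlas 𝓘(ℝ, Coord n) ∞ N, ∀ p ∈ slit n N,
    p.1 ∈ e.source → (gMat F e (coords e p)).PosDef

/-- The coefficients
`G^a = ¼ g^{ab} ((∂²F²/∂y^b∂x^c) y^c - ∂F²/∂x^b)`. -/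
def sprayG (F : TB n N → ℝ) (e : OpenPartialHomeomorph N (Coord n)) (a : Fin n)
    (z : Coord n × Coord n) : ℝ :=
  (1 / 4 : ℝ) * ∑ b, (gMat F e z)⁻¹ a b *
    ((∑ c, pdy b (pdx c (sqF F e)) z * z.2 c) - pdx b (sqF F e) z)

/-- `G^a_b = ∂G^a/∂y^b`. -/
def nlc (F : TB n N → ℝ) (e : OpenPartialHomeomorph N (Coord n)) (a b : Fin n)
    (z : Coord n × Coord n) : ℝ :=
  pdy b (sprayG F e a) z

/-- The differential at `p` of the coordinate map `(x, y)`. -/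
def dcoords (e : OpenPartialHomeomorph N (Coord n)) (p : TB n N) :
    TangentSpace (TI n) p →L[ℝ] Coord n × Coord n :=
  mfderiv (TI n) 𝓘(ℝ, Coord n × Coord n) (coords e) p

/-- The one-form `dx^a`. -/
def dx (e : OpenPartialHomeomorph N (Coord n)) (a : Fin n) (p : TB n N) :
    TangentSpace (TI n) p →L[ℝ] ℝ :=
  ((EuclideanSpace.proj a : Coord n →L[ℝ] ℝ).comp
    (ContinuousLinearMap.fst ℝ (Coord n) (Coord n))).comp (dcoords e p)

/-- The one-form `dy^a`. -/
def dy (e : OpenPartialHomeomorph N (Coord n)) (a : Fin n) (p : TB n N) :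
    TangentSpace (TI n) p →L[ℝ] ℝ :=
  ((EuclideanSpace.proj a : Coord n →L[ℝ] ℝ).comp
    (ContinuousLinearMap.snd ℝ (Coord n) (Coord n))).comp (dcoords e p)

/-- The one-form `δy^a = dy^a + G^a_b dx^b`. -/
def deltaY (F : TB n N → ℝ) (e : OpenPartialHomeomorph N (Coord n)) (a : Fin n) (p : TB n N) :
    TangentSpace (TI n) p →L[ℝ] ℝ :=
  dy e a p + ∑ b, nlc F e a b (coords e p) • dx e b p

/-- The coordinate vector `∂/∂x^a` at `p`. -/
def dDx (e : OpenPartialHomeomorph N (Coord n)) (a : Fin n) (p : TB n N) :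
    TangentSpace (TI n) p :=
  (dcoords e p).inverse (stdB a, 0)

/-- The coordinate vector `∂/∂y^a` at `p`. -/
def dDy (e : OpenPartialHomeomorph N (Coord n)) (a : Fin n) (p : TB n N) :
    TangentSpace (TI n) p :=
  (dcoords e p).inverse (0, stdB a)

/-- The horizontal vector `δ/δx^a = ∂/∂x^a - G^b_a ∂/∂y^b` at `p`. -/
def deltaX (F : TB n N → ℝ) (e : OpenPartialHomeomorph N (Coord n)) (a : Fin n) (p : TB n N) :
    TangentSpace (TI n) p :=
  dDx e a p - ∑ b, nlc F e b a (coords e p) • dDy e b p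

/-! The global objects on `TN⁰`. Each has the same expression in all charts; its value at `p` is
written in the preferred chart of `N` at the base point of `p`. -/

/-- The preferred chart of `N` at the base point of `p`. -/
def pchart (p : TB n N) : OpenPartialHomeomorph N (Coord n) := chartAt (Coord n) p.1

/-- The projector `V` on the vertical distribution, spanned by the `∂/∂y^i`, along the horizontal
one, spanned by the `δ/δx^a`. -/
def vertP (F : TB n N → ℝ) (p : TB n N) : TangentSpace (TI n) p →L[ℝ] TangentSpace (TI n) p :=
  ∑ i, (deltaY F (pchart p) i p).smulRight (dDy (pchart p) i p)

/-- The projector `H` on the horizontal distribution along the vertical one. -/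
def horP (F : TB n N → ℝ) (p : TB n N) : TangentSpace (TI n) p →L[ℝ] TangentSpace (TI n) p :=
  ∑ a, (dx (pchart p) a p).smulRight (deltaX F (pchart p) a p)

/-- The adjoint structure `Θ = δ/δx^i ⊗ δy^i`. -/
def adjointStr (F : TB n N → ℝ) (p : TB n N) :
    TangentSpace (TI n) p →L[ℝ] TangentSpace (TI n) p :=
  ∑ i, (deltaY F (pchart p) i p).smulRight (deltaX F (pchart p) i p)

/-- The Sasaki-Finsler metric `G`. -/
def sasaki (F : TB n N → ℝ) (p : TB n N) (v w : TangentSpace (TI n) p) : ℝ :=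
  ∑ a, ∑ b, gMat F (pchart p) (coords (pchart p) p) a b *
    (dx (pchart p) a p v * dx (pchart p) b p w
      + deltaY F (pchart p) a p v * deltaY F (pchart p) b p w)

/-- The Liouville vector field `L = y^i ∂/∂y^i`. -/
def liouville (p : TB n N) : TangentSpace (TI n) p :=
  ∑ i, (coords (pchart p) p).2 i • dDy (pchart p) i p

/-- The geodesic spray (transversal Liouville vector field) `L* = y^a δ/δx^a`. -/
def geoSpray (F : TB n N → ℝ) (p : TB n N) : TangentSpace (TI n) p :=
  ∑ a, (coords (pchart p) p).2 a • deltaX F (pchart p) a p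

/-- The Cartan form `θ_F = ½ (∂F²/∂y^a) dx^a`. -/
def cartanForm (F : TB n N → ℝ) (p : TB n N) : TangentSpace (TI n) p →L[ℝ] ℝ :=
  ∑ a, ((1 / 2 : ℝ) * pdy a (sqF F (pchart p)) (coords (pchart p) p)) • dx (pchart p) a p

/-- The Vranceanu connection `∇*_X Y` of the Weyl manifold `(TN⁰, G, W)` and the vertical
distribution. -/
def nablaStar (F : TB n N → ℝ)
    (W : (Π p : TB n N, TangentSpace (TI n) p → TangentSpace (TI n) p → ℝ) →
      Π p : TB n N, TangentSpace (TI n) p →L[ℝ] ℝ)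
    (X Y : Π p : TB n N, TangentSpace (TI n) p) (p : TB n N) : TangentSpace (TI n) p :=
  SubWeyl.vranceanu (TI n) (sasaki F) (W (sasaki F)) (vertP F) (horP F) X Y p

end

end Finsler

end

noncomputable section

namespace Finsler

set_option linter.unusedSectionVars false

open Filter Topology

/-! ## Homogeneous functions and sprays on a vector space -/

section Calculus

variable {V : Type*} [NormedAddCommGroup V] [NormedSpace ℝ V]

/-! Fix a chart and write `E = F²`, `g` for the fibre metric, `y` for the fibre coordinate and `N =
∂G/∂y` for the nonlinear connection. The vertical distribution is trivialised by `v ↦ (0, v)`, the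
horizontal one by `v ↦ (v, -N v)`. Both trivialisations are isometric for the Sasaki–Finsler metric,
and a projected bracket of sections becomes a difference of directional derivatives of their
components (`IsAdaptedFrame`). The Koszul formula then collapses (`koszul_trivial`): besides the
Weyl terms it contains only derivatives of `g` and the derivative of the component of the
differentiated section. For `L` and `L*` that component is `y`, which leaves four computations.

Vertical derivative of `L`: the derivatives of `g` are values of the Cartan tensor with `y` in a
slot and vanish by homogeneity, while `y` differentiates to the vertical part of `X`. Horizontal
derivative of `L`: the vertical part of `[HX, L]` vanishes because `N` is homogeneous of degree one
(`fderiv_nonlin_vert`). Horizontal derivative of `L*`: along the lift of `a`, `y` differentiates to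
`-N a`, and the derivatives of `g` contribute exactly the opposite term (`third_hlift`), a
consequence of the Euler–Lagrange equations. Vertical derivative of `L*`: the horizontal part of
`[VX, L*]` is `Θ X`. Only the Weyl terms remain. For the Cartan form, `θ = 0` and `ρ` is dual to
`y`, so two of the three horizontal Weyl terms cancel and the third is `½ F² HX`.

The global objects are written at each point in the preferred chart there, which varies with the
point, so before differentiating they must be rewritten in one fixed chart. The transformation laws
`spray_eq` and `nonlin_eq` show that changes of chart preserve horizontal lifts; hence vertical and
horizontal components transform linearly (`change_components`). -/

lemma two_le_infty : (2 : WithTop ℕ∞) ≤ ∞ :=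
  WithTop.coe_le_coe.2 (le_top : (2 : ℕ∞) ≤ ⊤)

/-- The second derivative of `E`. -/
abbrev hess (E : V × V → ℝ) : V × V → V × V →L[ℝ] V × V →L[ℝ] ℝ := fderiv ℝ (fderiv ℝ E)

/-- The third derivative of `E`. -/
abbrev third (E : V × V → ℝ) : V × V → V × V →L[ℝ] V × V →L[ℝ] V × V →L[ℝ] ℝ :=
  fderiv ℝ (hess E)

/-- The vertical endomorphism `(x, y) ↦ (0, y)` of `V × V`. -/
def vertEnd (V : Type*) [NormedAddCommGroup V] [NormedSpace ℝ V] : V × V →L[ℝ] V × V :=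
  (ContinuousLinearMap.inr ℝ V V).comp (ContinuousLinearMap.snd ℝ V V)

@[simp] lemma vertEnd_apply (z : V × V) : vertEnd V z = (0, z.2) := rfl

/-- `E` is smooth, positively homogeneous of degree two in the second variable and fibrewise
strongly convex on the open set `U`. -/
structure IsLocalFinsler (E : V × V → ℝ) (U : Set (V × V)) : Prop where
  isOpen : IsOpen U
  smooth : ContDiffOn ℝ ∞ E U
  homog : ∀ z ∈ U, ∀ c : ℝ, 0 < c → (z.1, c • z.2) ∈ U ∧ E (z.1, c • z.2) = c ^ 2 * E z
  pos : ∀ z ∈ U, ∀ v : V, v ≠ 0 → 0 < hess E z (0, v) (0, v)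

namespace IsLocalFinsler

variable {E : V × V → ℝ} {U : Set (V × V)} {z : V × V}

lemma contDiffAt (h : IsLocalFinsler E U) (hz : z ∈ U) : ContDiffAt ℝ ∞ E z :=
  h.smooth.contDiffAt (h.isOpen.mem_nhds hz)

lemma contDiffAt_fderiv (h : IsLocalFinsler E U) (hz : z ∈ U) : ContDiffAt ℝ ∞ (fderiv ℝ E) z :=
  (h.contDiffAt hz).fderiv_right le_rfl

lemma contDiffAt_hess (h : IsLocalFinsler E U) (hz : z ∈ U) : ContDiffAt ℝ ∞ (hess E) z :=
  (h.contDiffAt_fderiv hz).fderiv_right le_rfl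

lemma differentiableAt_fderiv (h : IsLocalFinsler E U) (hz : z ∈ U) :
    DifferentiableAt ℝ (fderiv ℝ E) z :=
  (h.contDiffAt_fderiv hz).differentiableAt (by simp)

lemma differentiableAt_hess (h : IsLocalFinsler E U) (hz : z ∈ U) :
    DifferentiableAt ℝ (hess E) z :=
  (h.contDiffAt_hess hz).differentiableAt (by simp)

lemma hess_symm (h : IsLocalFinsler E U) (hz : z ∈ U) (p q : V × V) :
    hess E z p q = hess E z q p :=
  ((h.contDiffAt hz).isSymmSndFDerivAt (by simpa using two_le_infty)).eq p q

lemma third_symm_left (h : IsLocalFinsler E U) (hz : z ∈ U) (p q r : V × V) :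
    third E z p q r = third E z q p r := by
  rw [((h.contDiffAt_fderiv hz).isSymmSndFDerivAt (by simpa using two_le_infty)).eq p q]

/-- The Hessian is symmetric at every point of the open set `U`, so its symmetry can be
differentiated. -/
lemma third_symm_right (h : IsLocalFinsler E U) (hz : z ∈ U) (p q r : V × V) :
    third E z p q r = third E z p r q := by
  have key : ∀ q r : V × V, fderiv ℝ (fun w => hess E w q r) z p = third E z p q r := by
    intro q r
    have h1 := (((h.differentiableAt_hess hz).hasFDerivAt.clm_apply
      (hasFDerivAt_const q z)).clm_apply (hasFDerivAt_const r z)).fderiv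
    rw [h1]; simp
  rw [← key q r, ← key r q]
  congr 1
  apply Filter.EventuallyEq.fderiv_eq
  filter_upwards [h.isOpen.mem_nhds hz] with w hw using h.hess_symm hw q r

/-- Euler's relation: differentiate `E (x, c y) = c² E (x, y)` at `c = 1`. -/
lemma fderiv_vert (h : IsLocalFinsler E U) (hz : z ∈ U) :
    fderiv ℝ E z (0, z.2) = 2 * E z := by
  have hE := ((h.contDiffAt hz).differentiableAt (by simp)).hasFDerivAt
  have hγ : HasDerivAt (fun c : ℝ => (z.1, c • z.2)) ((0 : V), z.2) 1 := by
    simpa using (hasDerivAt_const (1 : ℝ) z.1).prodMk ((hasDerivAt_id (1 : ℝ)).smul_const z.2)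
  have hE' : HasFDerivAt E (fderiv ℝ E z) (z.1, (1 : ℝ) • z.2) := by simpa using hE
  have h1 := hE'.comp_hasDerivAt (1 : ℝ) hγ
  have h2 : HasDerivAt (fun c : ℝ => c ^ 2 * E z) (2 * E z) 1 := by
    simpa using (hasDerivAt_pow 2 (1 : ℝ)).mul_const (E z)
  have h3 : (E ∘ fun c : ℝ => (z.1, c • z.2)) =ᶠ[𝓝 1] fun c : ℝ => c ^ 2 * E z := by
    filter_upwards [lt_mem_nhds (zero_lt_one (α := ℝ))] with c hc using (h.homog z hz c hc).2
  exact (h1.congr_of_eventuallyEq h3.symm).unique h2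

/-- The derivative of Euler's relation; the first-order term on the left comes from differentiating
the Liouville field `(0, y)`. -/
lemma hess_vert (h : IsLocalFinsler E U) (hz : z ∈ U) (p : V × V) :
    hess E z p (0, z.2) + fderiv ℝ E z (0, p.2) = 2 * fderiv ℝ E z p := by
  have h1 := ((h.differentiableAt_fderiv hz).hasFDerivAt.clm_apply
    ((vertEnd V).hasFDerivAt (x := z)))
  have h2 := (((h.contDiffAt hz).differentiableAt (by simp)).hasFDerivAt).const_mul 2
  have h3 : (fun w => fderiv ℝ E w (vertEnd V w)) =ᶠ[𝓝 z] fun w => 2 * E w := by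
    filter_upwards [h.isOpen.mem_nhds hz] with w hw using h.fderiv_vert hw
  have h4 := DFunLike.congr_fun ((h1.congr_of_eventuallyEq h3.symm).unique h2) p
  simp at h4
  linarith

lemma third_vert (h : IsLocalFinsler E U) (hz : z ∈ U) (q p : V × V) :
    third E z q p (0, z.2) + hess E z p (0, q.2) + hess E z q (0, p.2) = 2 * hess E z q p := by
  have h1 := (((h.differentiableAt_hess hz).hasFDerivAt.clm_apply
    (hasFDerivAt_const p z)).clm_apply ((vertEnd V).hasFDerivAt (x := z))).add
    ((h.differentiableAt_fderiv hz).hasFDerivAt.clm_apply (hasFDerivAt_const ((0 : V), p.2) z))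
  have h2 := (((h.differentiableAt_fderiv hz).hasFDerivAt.clm_apply
    (hasFDerivAt_const p z))).const_mul 2
  have h3 : (fun w => hess E w p (vertEnd V w) + fderiv ℝ E w (0, p.2)) =ᶠ[𝓝 z]
      fun w => 2 * fderiv ℝ E w p := by
    filter_upwards [h.isOpen.mem_nhds hz] with w hw using h.hess_vert hw p
  have h4 := DFunLike.congr_fun ((h1.congr_of_eventuallyEq h3.symm).unique h2) q
  simp at h4
  linarith

/-- For vertical `q` the right-hand side vanishes by symmetry of the Hessian: the Cartan tensor
annihilates `y`. For `q = (a, 0)` only the mixed term `hess E z q (0, v)` survives. -/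
lemma third_vert_vert (h : IsLocalFinsler E U) (hz : z ∈ U) (q : V × V) (v : V) :
    third E z q (0, v) (0, z.2) = hess E z q (0, v) - hess E z (0, v) (0, q.2) := by
  have := h.third_vert hz q (0, v)
  simp only at this
  linarith

lemma third_vert_left (h : IsLocalFinsler E U) (hz : z ∈ U) (q : V × V) (v : V) :
    third E z (0, z.2) (0, v) q = hess E z q (0, v) - hess E z (0, v) (0, q.2) := by
  rw [h.third_symm_left hz, h.third_symm_right hz, h.third_symm_left hz, h.third_vert_vert hz]

/-- Positivity gives nondegeneracy on testing with `v = u - w`. Identities between spray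
coefficients are proved by pairing them with the metric. -/
lemma eq_of_hess_vert (h : IsLocalFinsler E U) (hz : z ∈ U) {u w : V}
    (huw : ∀ v : V, hess E z (0, v) (0, u) = hess E z (0, v) (0, w)) : u = w := by
  by_contra hne
  have h1 := h.pos z hz (u - w) (sub_ne_zero.2 hne)
  have h2 : ((0 : V), u - w) = (0, u) - (0, w) := by simp
  have h3 := huw (u - w)
  rw [h2] at h1 h3
  rw [map_sub (hess E z _), h3] at h1
  simp at h1

end IsLocalFinsler

/-! ### Sprays, the nonlinear connection and horizontal derivatives -/

/-- `G` is the vector of spray coefficients of `E` on `U`. -/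
structure IsSprayOn (E : V × V → ℝ) (G : V × V → V) (U : Set (V × V)) : Prop
    extends IsLocalFinsler E U where
  smoothG : ∀ z ∈ U, ContDiffAt ℝ ∞ G z
  eulerLagrange : ∀ z ∈ U, ∀ v : V,
    2 * hess E z (0, v) (0, G z) = hess E z (0, v) (z.2, 0) - fderiv ℝ E z (v, 0)

/-- The nonlinear connection `∂G/∂y`. -/
def nonlin (G : V × V → V) (z : V × V) : V →L[ℝ] V :=
  (fderiv ℝ G z).comp (ContinuousLinearMap.inr ℝ V V)

lemma nonlin_apply (G : V × V → V) (z : V × V) (v : V) : nonlin G z v = fderiv ℝ G z (0, v) := rfl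

/-- The horizontal lift of `v`. -/
def hlift (G : V × V → V) (z : V × V) (v : V) : V × V := (v, -nonlin G z v)

namespace IsSprayOn

variable {E : V × V → ℝ} {G : V × V → V} {U : Set (V × V)} {z : V × V}

lemma contDiffAt_nonlin (h : IsSprayOn E G U) (hz : z ∈ U) : ContDiffAt ℝ ∞ (nonlin G) z :=
  ((h.smoothG z hz).fderiv_right (m := ∞) le_rfl).clm_comp contDiffAt_const

lemma differentiableAt_nonlin (h : IsSprayOn E G U) (hz : z ∈ U) :
    DifferentiableAt ℝ (nonlin G) z :=
  (h.contDiffAt_nonlin hz).differentiableAt (by simp)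

lemma hasFDerivAt_spray (h : IsSprayOn E G U) (hz : z ∈ U) :
    HasFDerivAt G (fderiv ℝ G z) z :=
  ((h.smoothG z hz).differentiableAt (by simp)).hasFDerivAt

/-- The derivative of the Euler-Lagrange equations. -/
lemma fderiv_eulerLagrange (h : IsSprayOn E G U) (hz : z ∈ U) (q : V × V) (v : V) :
    2 * (third E z q (0, v) (0, G z) + hess E z (0, v) (0, fderiv ℝ G z q)) =
      third E z q (0, v) (z.2, 0) + hess E z (0, v) (q.2, 0) - hess E z q (v, 0) := by
  have hv := (h.differentiableAt_hess hz).hasFDerivAt.clm_apply (hasFDerivAt_const ((0 : V), v) z)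
  have h1 := (hv.clm_apply ((ContinuousLinearMap.inr ℝ V V).hasFDerivAt.comp z
    (h.hasFDerivAt_spray hz))).const_mul 2
  have h2 := (hv.clm_apply (((ContinuousLinearMap.inl ℝ V V).comp
    (ContinuousLinearMap.snd ℝ V V)).hasFDerivAt (x := z))).sub
    ((h.differentiableAt_fderiv hz).hasFDerivAt.clm_apply (hasFDerivAt_const (v, (0 : V)) z))
  have h3 : (fun w => 2 * hess E w (0, v) ((ContinuousLinearMap.inr ℝ V V ∘ G) w)) =ᶠ[𝓝 z]
      fun w => hess E w (0, v) (((ContinuousLinearMap.inl ℝ V V).comp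
        (ContinuousLinearMap.snd ℝ V V)) w) - fderiv ℝ E w (v, 0) := by
    filter_upwards [h.isOpen.mem_nhds hz] with w hw using h.eulerLagrange w hw v
  have h4 := DFunLike.congr_fun ((h1.congr_of_eventuallyEq h3.symm).unique h2) q
  simp at h4
  linarith

/-- Spray coefficients are homogeneous of degree two. -/
lemma nonlin_self (h : IsSprayOn E G U) (hz : z ∈ U) : nonlin G z z.2 = (2 : ℝ) • G z := by
  apply h.eq_of_hess_vert hz
  intro v
  -- The Euler–Lagrange equations are differentiated along the Liouville direction, where all third
  -- derivatives reduce to second ones.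
  have h1 := h.fderiv_eulerLagrange hz (0, z.2) v
  have h2 := h.eulerLagrange z hz v
  have h3 := h.hess_vert hz (v, 0)
  have e0 : hess E z (0, v) (0, (2 : ℝ) • G z) = 2 * hess E z (0, v) (0, G z) := by
    rw [show ((0 : V), (2 : ℝ) • G z) = (2 : ℝ) • (0, G z) by simp, map_smul, smul_eq_mul]
  have e1 := h.hess_symm hz (0, v) (0, G z)
  have e2 := h.hess_symm hz (0, v) (z.2, 0)
  have e3 := h.hess_symm hz (0, z.2) (v, 0)
  have e4 : hess E z (0, v) ((0 : V), 0) = 0 := map_zero _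
  have e5 : fderiv ℝ E z ((0 : V), 0) = 0 := map_zero _
  rw [h.third_vert_left hz, h.third_vert_left hz] at h1
  simp only at h1 h3
  rw [nonlin_apply]
  linarith

/-- The nonlinear connection is homogeneous of degree one. -/
lemma fderiv_nonlin_vert (h : IsSprayOn E G U) (hz : z ∈ U) :
    fderiv ℝ (nonlin G) z (0, z.2) = nonlin G z := by
  have hN : ∀ p v, fderiv ℝ (nonlin G) z p v = fderiv ℝ (fderiv ℝ G) z p (0, v) := by
    intro p v
    have hd : DifferentiableAt ℝ (fderiv ℝ G) z :=
      ((h.smoothG z hz).fderiv_right (m := ∞) le_rfl).differentiableAt (by simp)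
    have := (hd.hasFDerivAt.clm_comp (hasFDerivAt_const (ContinuousLinearMap.inr ℝ V V) z)).fderiv
    unfold nonlin
    rw [this]
    simp
  ext w
  have h1 := (h.differentiableAt_nonlin hz).hasFDerivAt.clm_apply
    ((ContinuousLinearMap.snd ℝ V V).hasFDerivAt (x := z))
  have h2 := (h.hasFDerivAt_spray hz).const_smul (2 : ℝ)
  have h3 : (fun w => nonlin G w (ContinuousLinearMap.snd ℝ V V w)) =ᶠ[𝓝 z]
      fun w => (2 : ℝ) • G w := by
    filter_upwards [h.isOpen.mem_nhds hz] with w hw using h.nonlin_self hw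
  -- Differentiating `N y = 2 G` along `(0, w)` gives `(∂_w N) y + N w = 2 N w`; the symmetry `h5`
  -- of the second derivative of `G` turns `(∂_w N) y` into `(∂_y N) w`.
  have h4 := DFunLike.congr_fun ((h1.congr_of_eventuallyEq h3.symm).unique h2) (0, w)
  have h5 := ((h.smoothG z hz).isSymmSndFDerivAt (by simpa using two_le_infty)).eq (0, z.2) (0, w)
  rw [hN, h5, ← hN]
  simp [← nonlin_apply, two_smul] at h4
  exact h4

/-- The horizontal derivative of the metric, contracted with the Liouville field, is given by the
nonlinear connection. -/
lemma third_hlift (h : IsSprayOn E G U) (hz : z ∈ U) (a c : V) :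
    third E z (hlift G z a) (0, z.2) (0, c) + third E z (hlift G z z.2) (0, c) (0, a)
      - third E z (hlift G z c) (0, a) (0, z.2) = 2 * hess E z (0, nonlin G z a) (0, c) := by
  have hs : ∀ v, hlift G z v = (v, 0) - (0, nonlin G z v) := by intro v; simp [hlift]
  -- By homogeneity the first and third terms of the goal reduce to the mixed Hessians of `(a, 0)`,
  -- `(0, c)` and of `(c, 0)`, `(0, a)`. Since the lift of `y` is `(y, -2 G)`, the middle term
  -- supplies the third derivatives of the vertically differentiated Euler–Lagrange equation.
  have h1 := h.fderiv_eulerLagrange hz (0, a) c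
  have t1 := h.third_vert_vert hz (a, 0) c
  have t2 := h.third_vert_vert hz (0, nonlin G z a) c
  have t3 := h.third_vert_vert hz (c, 0) a
  have t4 := h.third_vert_vert hz (0, nonlin G z c) a
  have e1 := h.hess_symm hz (0, nonlin G z a) (0, c)
  have e2 := h.hess_symm hz (0, nonlin G z c) (0, a)
  have e3 := h.hess_symm hz (0, c) (a, 0)
  have e4 := h.hess_symm hz (0, a) (c, 0)
  have e5 : ∀ v, hess E z (0, v) ((0 : V), 0) = 0 := fun v => map_zero _
  have r : ∀ q, third E z (0, a) (0, c) q = third E z q (0, c) (0, a) := by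
    intro q
    rw [h.third_symm_left hz, h.third_symm_right hz, h.third_symm_left hz]
  have e6 : third E z (0, (2 : ℝ) • G z) (0, c) (0, a) = 2 * third E z (0, G z) (0, c) (0, a) := by
    rw [show ((0 : V), (2 : ℝ) • G z) = (2 : ℝ) • (0, G z) by simp, map_smul]; rfl
  rw [r, r] at h1
  rw [h.third_symm_right hz _ (0, z.2)]
  simp only [hs, h.nonlin_self hz, map_sub, sub_apply]
  simp only [e5] at t1 t2 t3 t4
  rw [← nonlin_apply] at h1
  linarith

end IsSprayOn

/-! ### Change of coordinates -/

/-- The map of `V × V` induced by the change of coordinates `φ`. -/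
def tangentChange (φ : V → V) (z : V × V) : V × V := (φ z.1, fderiv ℝ φ z.1 z.2)

lemma hasFDerivAt_tangentChange {φ : V → V} {z : V × V} (hφ : ContDiffAt ℝ ∞ φ z.1) :
    HasFDerivAt (tangentChange φ)
      (((fderiv ℝ φ z.1).comp (ContinuousLinearMap.fst ℝ V V)).prod
        (((fderiv ℝ φ z.1).comp (ContinuousLinearMap.snd ℝ V V)) +
          ((fderiv ℝ (fderiv ℝ φ) z.1).comp (ContinuousLinearMap.fst ℝ V V)).flip z.2)) z := by
  have h1 : HasFDerivAt (fun w : V × V => φ w.1) _ z :=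
    ((hφ.differentiableAt (by simp)).hasFDerivAt).comp z hasFDerivAt_fst
  have h2 : HasFDerivAt (fun w : V × V => fderiv ℝ φ w.1) _ z :=
    (((hφ.fderiv_right (m := ∞) le_rfl).differentiableAt (by simp)).hasFDerivAt).comp z
      hasFDerivAt_fst
  exact h1.prodMk (h2.clm_apply hasFDerivAt_snd)

lemma fderiv_tangentChange {φ : V → V} {z : V × V} (hφ : ContDiffAt ℝ ∞ φ z.1) (p : V × V) :
    fderiv ℝ (tangentChange φ) z p =
      (fderiv ℝ φ z.1 p.1, fderiv ℝ φ z.1 p.2 + fderiv ℝ (fderiv ℝ φ) z.1 p.1 z.2) := by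
  rw [(hasFDerivAt_tangentChange hφ).fderiv]
  simp

/-- `φ` changes the Finsler function `E` on `U` to `E'` on `U'`. -/
structure IsChange (φ : V → V) (E : V × V → ℝ) (U : Set (V × V)) (E' : V × V → ℝ)
    (U' : Set (V × V)) : Prop where
  isOpen : IsOpen U
  mapsTo : ∀ z ∈ U, tangentChange φ z ∈ U'
  smooth : ∀ z ∈ U, ContDiffAt ℝ ∞ φ z.1
  eq : ∀ z ∈ U, E z = E' (tangentChange φ z)

namespace IsChange

variable {φ : V → V} {E E' : V × V → ℝ} {U U' : Set (V × V)} {z : V × V} {G G' : V × V → V}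

lemma fderiv_eq (h : IsChange φ E U E' U') (hE' : IsLocalFinsler E' U') (hz : z ∈ U)
    (p : V × V) : fderiv ℝ E z p =
      fderiv ℝ E' (tangentChange φ z) (fderiv ℝ (tangentChange φ) z p) := by
  have h1 : E =ᶠ[𝓝 z] E' ∘ tangentChange φ := by
    filter_upwards [h.isOpen.mem_nhds hz] with w hw using h.eq w hw
  rw [h1.fderiv_eq, fderiv_comp _ ((hE'.contDiffAt (h.mapsTo z hz)).differentiableAt (by simp))
    (hasFDerivAt_tangentChange (h.smooth z hz)).differentiableAt]
  rfl

/-- The image `(0, Dφ v)` of the constant vector `(0, v)` depends on the base point, whence the term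
with `D²φ`. It vanishes for vertical `q`, which makes the fibre metric a tensor. -/
lemma hess_eq (h : IsChange φ E U E' U') (hE : IsLocalFinsler E U) (hE' : IsLocalFinsler E' U')
    (hz : z ∈ U) (q : V × V) (v : V) : hess E z q (0, v) =
      hess E' (tangentChange φ z) (fderiv ℝ (tangentChange φ) z q) (0, fderiv ℝ φ z.1 v) +
        fderiv ℝ E' (tangentChange φ z) (0, fderiv ℝ (fderiv ℝ φ) z.1 q.1 v) := by
  have hφ := h.smooth z hz
  have hT := hasFDerivAt_tangentChange hφ
  have h0 : HasFDerivAt (fun w => fderiv ℝ E w (0, v)) _ z :=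
    (hE.differentiableAt_fderiv hz).hasFDerivAt.clm_apply (hasFDerivAt_const ((0 : V), v) z)
  have h2 : HasFDerivAt (fun w : V × V => fderiv ℝ φ w.1) _ z :=
    (((hφ.fderiv_right (m := ∞) le_rfl).differentiableAt (by simp)).hasFDerivAt).comp z
      hasFDerivAt_fst
  have h3 := (ContinuousLinearMap.inr ℝ V V).hasFDerivAt.comp z
    (h2.clm_apply (hasFDerivAt_const v z))
  have h4 := ((hE'.differentiableAt_fderiv (h.mapsTo z hz)).hasFDerivAt.comp z hT).clm_apply h3
  have h5 : (fun w => fderiv ℝ E w (0, v)) =ᶠ[𝓝 z] fun w =>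
      ((fderiv ℝ E' ∘ tangentChange φ) w) ((ContinuousLinearMap.inr ℝ V V ∘
        fun w : V × V => fderiv ℝ φ w.1 v) w) := by
    filter_upwards [h.isOpen.mem_nhds hz] with w hw
    rw [h.fderiv_eq hE' hw, fderiv_tangentChange (h.smooth w hw)]
    simp
  have h6 := DFunLike.congr_fun ((h4.congr_of_eventuallyEq h5).unique h0) q
  rw [fderiv_tangentChange hφ]
  simp at h6
  linarith

/-- The transformation law of spray coefficients. -/
lemma spray_eq (h : IsChange φ E U E' U') (hE : IsSprayOn E G U) (hE' : IsSprayOn E' G' U')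
    (hz : z ∈ U) (hsurj : Function.Surjective (fderiv ℝ φ z.1)) :
    G' (tangentChange φ z) =
      fderiv ℝ φ z.1 (G z) - (1 / 2 : ℝ) • fderiv ℝ (fderiv ℝ φ) z.1 z.2 z.2 := by
  have hφ := h.smooth z hz
  have hz' := h.mapsTo z hz
  apply hE'.eq_of_hess_vert hz'
  intro v'
  obtain ⟨v, rfl⟩ := hsurj v'
  have h1 := hE.eulerLagrange z hz v
  have h2 := hE'.eulerLagrange _ hz' (fderiv ℝ φ z.1 v)
  have h3 := h.hess_eq hE.toIsLocalFinsler hE'.toIsLocalFinsler hz (0, G z) v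
  have h4 := h.hess_eq hE.toIsLocalFinsler hE'.toIsLocalFinsler hz (z.2, 0) v
  have h5 := h.fderiv_eq hE'.toIsLocalFinsler hz (v, 0)
  -- Symmetry of `D²φ` makes the first-derivative corrections in `h4` and `h5` cancel in the
  -- Euler–Lagrange expression; the second component `D²φ(y, y)` of the image of `(y, 0)` survives
  -- and produces the inhomogeneous term.
  have hsy := (hφ.isSymmSndFDerivAt (by simpa using two_le_infty)).eq z.2 v
  rw [hE.hess_symm hz] at h3 h4
  rw [fderiv_tangentChange hφ] at h3 h4 h5
  simp only [map_zero, _root_.zero_apply, add_zero, zero_add] at h3 h4 h5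
  have hT : tangentChange φ z = (φ z.1, fderiv ℝ φ z.1 z.2) := rfl
  rw [hsy] at h4
  have e0 : fderiv ℝ E' (tangentChange φ z) ((0 : V), 0) = 0 := map_zero _
  have e1 := hE'.hess_symm hz' (0, fderiv ℝ φ z.1 v) (0, fderiv ℝ φ z.1 (G z))
  have split : ∀ (a b : V), ((a, b) : V × V) = (a, 0) + (0, b) := by intro a b; simp
  have e2 := hE'.hess_symm hz' (0, fderiv ℝ φ z.1 v) ((tangentChange φ z).2, 0)
  have e3 := hE'.hess_symm hz' (0, fderiv ℝ φ z.1 v)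
    (0, fderiv ℝ (fderiv ℝ φ) z.1 z.2 z.2)
  rw [split (fderiv ℝ φ z.1 z.2), map_add, add_apply] at h4
  rw [split (fderiv ℝ φ z.1 v), map_add] at h5
  have e4 : ((0 : V), fderiv ℝ φ z.1 (G z) - (1 / 2 : ℝ) • fderiv ℝ (fderiv ℝ φ) z.1 z.2 z.2) =
      (0, fderiv ℝ φ z.1 (G z)) - (1 / 2 : ℝ) • (0, fderiv ℝ (fderiv ℝ φ) z.1 z.2 z.2) := by
    simp
  rw [e4, map_sub, map_smul, smul_eq_mul]
  have e5 : (tangentChange φ z).2 = fderiv ℝ φ z.1 z.2 := rfl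
  rw [e5] at h2 e2
  linarith

/-- The transformation law of the nonlinear connection. -/
lemma nonlin_eq (h : IsChange φ E U E' U') (hE : IsSprayOn E G U) (hE' : IsSprayOn E' G' U')
    (hsurj : ∀ w ∈ U, Function.Surjective (fderiv ℝ φ w.1)) (hz : z ∈ U) (v : V) :
    nonlin G' (tangentChange φ z) (fderiv ℝ φ z.1 v) =
      fderiv ℝ φ z.1 (nonlin G z v) - fderiv ℝ (fderiv ℝ φ) z.1 v z.2 := by
  have hφ := h.smooth z hz
  have hT := hasFDerivAt_tangentChange hφ
  have h1 := (hE'.hasFDerivAt_spray (h.mapsTo z hz)).comp z hT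
  have h2 : HasFDerivAt (fun w : V × V => fderiv ℝ φ w.1) _ z :=
    (((hφ.fderiv_right (m := ∞) le_rfl).differentiableAt (by simp)).hasFDerivAt).comp z
      hasFDerivAt_fst
  have h3 : HasFDerivAt (fun w : V × V => fderiv ℝ (fderiv ℝ φ) w.1) _ z :=
    ((((hφ.fderiv_right (m := ∞) le_rfl).fderiv_right (m := ∞) le_rfl).differentiableAt
      (by simp)).hasFDerivAt).comp z hasFDerivAt_fst
  have h4 := (h2.clm_apply (hE.hasFDerivAt_spray hz)).sub
    (((h3.clm_apply hasFDerivAt_snd).clm_apply hasFDerivAt_snd).const_smul (1 / 2 : ℝ))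
  have h5 : (G' ∘ tangentChange φ) =ᶠ[𝓝 z] fun w =>
      fderiv ℝ φ w.1 (G w) - (1 / 2 : ℝ) • fderiv ℝ (fderiv ℝ φ) w.1 w.2 w.2 := by
    filter_upwards [h.isOpen.mem_nhds hz] with w hw using h.spray_eq hE hE' hw (hsurj w hw)
  -- The law for `G` is differentiated vertically: by symmetry `½ D²φ(y, y)` has derivative `D²φ(v,
  -- y)`.
  have h6 := DFunLike.congr_fun ((h4.congr_of_eventuallyEq h5).unique h1) (0, v)
  have hsy := (hφ.isSymmSndFDerivAt (by simpa using two_le_infty)).eq z.2 v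
  simp [hsy, ← nonlin_apply] at h6
  rw [← h6, ← add_smul]
  norm_num

/-- Horizontal lifts are mapped to horizontal lifts. -/
lemma fderiv_hlift (h : IsChange φ E U E' U') (hE : IsSprayOn E G U) (hE' : IsSprayOn E' G' U')
    (hsurj : ∀ w ∈ U, Function.Surjective (fderiv ℝ φ w.1)) (hz : z ∈ U) (v : V) :
    fderiv ℝ (tangentChange φ) z (hlift G z v) =
      hlift G' (tangentChange φ z) (fderiv ℝ φ z.1 v) := by
  rw [fderiv_tangentChange (h.smooth z hz), hlift, hlift, h.nonlin_eq hE hE' hsurj hz]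
  simp [sub_eq_add_neg, add_comm]

end IsChange

/-! ### The Koszul formula for a metric along a map -/

/-- The derivative terms of the Koszul formula, for sections `a`, `b`, `c` of a trivial bundle with
metric `g`, anchored at the vectors `A`, `B`, `C` of the base. -/
lemma koszul_trivial {Z : Type*} [NormedAddCommGroup Z] [NormedSpace ℝ Z]
    {g : Z → V →L[ℝ] V →L[ℝ] ℝ} {a b c : Z → V} {z : Z} (A B C : Z)
    (hg : DifferentiableAt ℝ g z) (hsymm : ∀ u v, g z u v = g z v u)
    (ha : DifferentiableAt ℝ a z) (hb : DifferentiableAt ℝ b z) (hc : DifferentiableAt ℝ c z) :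
    fderiv ℝ (fun w => g w (b w) (c w)) z A + fderiv ℝ (fun w => g w (c w) (a w)) z B
      - fderiv ℝ (fun w => g w (a w) (b w)) z C
      + g z (fderiv ℝ b z A - fderiv ℝ a z B) (c z)
      - g z (fderiv ℝ c z B - fderiv ℝ b z C) (a z)
      + g z (fderiv ℝ a z C - fderiv ℝ c z A) (b z) =
    fderiv ℝ g z A (b z) (c z) + fderiv ℝ g z B (c z) (a z) - fderiv ℝ g z C (a z) (b z)
      + 2 * g z (fderiv ℝ b z A) (c z) := by
  have key : ∀ {u v : Z → V} (D : Z), DifferentiableAt ℝ u z → DifferentiableAt ℝ v z →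
      fderiv ℝ (fun w => g w (u w) (v w)) z D = fderiv ℝ g z D (u z) (v z)
        + g z (fderiv ℝ u z D) (v z) + g z (u z) (fderiv ℝ v z D) := by
    intro u v D hu hv
    rw [((hg.hasFDerivAt.clm_apply hu.hasFDerivAt).clm_apply hv.hasFDerivAt).fderiv]
    simp
    ring
  rw [key A hb hc, key B hc ha, key C ha hb]
  simp only [map_sub, sub_apply]
  rw [hsymm (b z) (fderiv ℝ c z A), hsymm (c z) (fderiv ℝ a z B), hsymm (a z) (fderiv ℝ b z C)]
  ring

end Calculus

/-! ## Induced coordinates on the tangent bundle -/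

section Coordinates

variable {n : ℕ} {N : Type*} [TopologicalSpace N] [ChartedSpace (Coord n) N]
  [IsManifold 𝓘(ℝ, Coord n) ∞ N]

lemma contMDiff_mk_tangentBundle : ContMDiff 𝓘(ℝ, Coord n × Coord n) (TI n) ∞
    (fun z => ⟨z.1, z.2⟩ : Coord n × Coord n → TangentBundle 𝓘(ℝ, Coord n) (Coord n)) := by
  have := contMDiff_tangentBundleModelSpaceHomeomorph_symm (I := 𝓘(ℝ, Coord n)) (n := ∞)
  rw [modelWithCornersSelf_prod]
  exact this

lemma contMDiff_tangentBundle_toProd : ContMDiff (TI n) 𝓘(ℝ, Coord n × Coord n) ∞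
    (fun p => (p.1, p.2) : TangentBundle 𝓘(ℝ, Coord n) (Coord n) → Coord n × Coord n) := by
  have := contMDiff_tangentBundleModelSpaceHomeomorph (I := 𝓘(ℝ, Coord n)) (n := ∞)
  rw [modelWithCornersSelf_prod]
  exact this

variable {e e' : OpenPartialHomeomorph N (Coord n)} {q : TB n N} {z : Coord n × Coord n}

lemma isOpen_preimage_proj {s : Set N} (hs : IsOpen s) : IsOpen {q : TB n N | q.1 ∈ s} :=
  hs.preimage (FiberBundle.continuous_proj (Coord n) (TangentSpace 𝓘(ℝ, Coord n)))

lemma eventually_mem_source (hq : q.1 ∈ e.source) : ∀ᶠ q' : TB n N in 𝓝 q, q'.1 ∈ e.source :=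
  (isOpen_preimage_proj e.open_source).mem_nhds hq

/-- Near `q`, `coords e` is the tangent map of `e` followed by the identification of the tangent
bundle of `ℝⁿ` with a product. -/
lemma contMDiffAt_coords (he : e ∈ IsManifold.maximalAtlas 𝓘(ℝ, Coord n) ∞ N)
    (hq : q.1 ∈ e.source) : ContMDiffAt (TI n) 𝓘(ℝ, Coord n × Coord n) ∞ (coords e) q := by
  have h1 := (contMDiffOn_of_mem_maximalAtlas he).contMDiffOn_tangentMapWithin (m := ∞) le_rfl
    e.open_source.uniqueMDiffOn
  have h2 := h1.contMDiffAt ((isOpen_preimage_proj e.open_source).mem_nhds hq)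
  refine (contMDiff_tangentBundle_toProd.contMDiffAt.comp q h2).congr_of_eventuallyEq ?_
  filter_upwards [eventually_mem_source hq] with q' hq'
  simp only [coords, Function.comp, tangentMapWithin]
  rw [mfderivWithin_of_mem_nhds (e.open_source.mem_nhds hq')]

lemma contMDiffAt_point (he : e ∈ IsManifold.maximalAtlas 𝓘(ℝ, Coord n) ∞ N)
    (hz : z.1 ∈ e.target) : ContMDiffAt 𝓘(ℝ, Coord n × Coord n) (TI n) ∞
      (point e : Coord n × Coord n → TB n N) z := by
  have h1 := (contMDiffOn_symm_of_mem_maximalAtlas he).contMDiffOn_tangentMapWithin (m := ∞) le_rfl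
    e.open_target.uniqueMDiffOn
  have h2 := h1.contMDiffAt (x := ⟨z.1, z.2⟩)
    ((isOpen_preimage_proj (N := Coord n) e.open_target).mem_nhds hz)
  refine (h2.comp z contMDiff_mk_tangentBundle.contMDiffAt).congr_of_eventuallyEq ?_
  filter_upwards [(e.open_target.preimage continuous_fst).mem_nhds hz] with w hw
  simp only [point, Function.comp, tangentMapWithin]
  rw [mfderivWithin_of_mem_nhds (e.open_target.mem_nhds hw)]

lemma mdifferentiable_of_mem_maximalAtlas
    (he : e ∈ IsManifold.maximalAtlas 𝓘(ℝ, Coord n) ∞ N) :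
    e.MDifferentiable 𝓘(ℝ, Coord n) 𝓘(ℝ, Coord n) :=
  ⟨(contMDiffOn_of_mem_maximalAtlas he).mdifferentiableOn (by simp),
    (contMDiffOn_symm_of_mem_maximalAtlas he).mdifferentiableOn (by simp)⟩

lemma coords_point (he : e ∈ IsManifold.maximalAtlas 𝓘(ℝ, Coord n) ∞ N) (hz : z.1 ∈ e.target) :
    coords e (point e z : TB n N) = z := by
  refine Prod.ext (e.right_inv hz) ?_
  exact DFunLike.congr_fun ((mdifferentiable_of_mem_maximalAtlas he).comp_symm_deriv hz) z.2

/-- Every fibre is a copy of `Coord n`, so vectors over base points that are only propositionally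
equal can be compared there. -/
lemma mk_eq_mk {x x' : N} (h : x' = x) {v : TangentSpace 𝓘(ℝ, Coord n) x}
    {v' : TangentSpace 𝓘(ℝ, Coord n) x'} (hv : (v' : Coord n) = v) :
    (⟨x', v'⟩ : TB n N) = ⟨x, v⟩ := by
  subst h
  exact congrArg _ hv

lemma point_coords (he : e ∈ IsManifold.maximalAtlas 𝓘(ℝ, Coord n) ∞ N) (hq : q.1 ∈ e.source) :
    point e (coords e q) = q := by
  obtain ⟨x, v⟩ := q
  refine mk_eq_mk (e.left_inv hq) ?_
  exact DFunLike.congr_fun ((mdifferentiable_of_mem_maximalAtlas he).symm_comp_deriv hq) v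

lemma coords_mem_target (hq : q.1 ∈ e.source) : (coords e q).1 ∈ e.target := e.map_source hq

lemma coords_ne_zero_iff (he : e ∈ IsManifold.maximalAtlas 𝓘(ℝ, Coord n) ∞ N)
    (hq : q.1 ∈ e.source) : (coords e q).2 ≠ 0 ↔ q ∈ slit n N := by
  have := (mdifferentiable_of_mem_maximalAtlas he).mfderiv_injective hq
  exact (map_ne_zero_iff _ this)

lemma point_mem_slit (he : e ∈ IsManifold.maximalAtlas 𝓘(ℝ, Coord n) ∞ N) (hz : z.1 ∈ e.target)
    (hz' : z.2 ≠ 0) : (point e z : TB n N) ∈ slit n N := by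
  rw [← coords_ne_zero_iff he (e.map_target hz), coords_point he hz]
  exact hz'

lemma isOpen_slit : IsOpen (slit n N) := by
  rw [isOpen_iff_mem_nhds]
  intro q hq
  have he := IsManifold.chart_mem_maximalAtlas (I := 𝓘(ℝ, Coord n)) (n := ∞) q.1
  have hs := mem_chart_source (Coord n) q.1
  have h1 := (contMDiffAt_coords he hs).continuousAt.snd
  have h2 := h1.eventually_ne ((coords_ne_zero_iff he hs).2 hq)
  filter_upwards [h2, eventually_mem_source hs] with q' h h'
  exact (coords_ne_zero_iff he h').1 h

/-! ### Vector fields and Lie brackets in induced coordinates -/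

lemma mdifferentiableAt_coords (he : e ∈ IsManifold.maximalAtlas 𝓘(ℝ, Coord n) ∞ N)
    (hq : q.1 ∈ e.source) : MDifferentiableAt (TI n) 𝓘(ℝ, Coord n × Coord n) (coords e) q :=
  (contMDiffAt_coords he hq).mdifferentiableAt (by simp)

/-- The local right inverse `point e` makes the differential surjective, and equal finite dimensions
give injectivity. -/
lemma dcoords_isInvertible (he : e ∈ IsManifold.maximalAtlas 𝓘(ℝ, Coord n) ∞ N)
    (hq : q.1 ∈ e.source) : (dcoords e q).IsInvertible := by
  have hsurj : Function.Surjective (dcoords e q) := by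
    obtain ⟨z, hz, rfl⟩ : ∃ z : Coord n × Coord n, z.1 ∈ e.target ∧ point e z = q :=
      ⟨coords e q, coords_mem_target hq, point_coords he hq⟩
    have h1 := mfderiv_comp z (mdifferentiableAt_coords he hq)
      ((contMDiffAt_point he hz).mdifferentiableAt (by simp))
    have h2 : (coords e ∘ (point e : Coord n × Coord n → TB n N)) =ᶠ[𝓝 z] id := by
      filter_upwards [(e.open_target.preimage continuous_fst).mem_nhds hz] with w hw
        using coords_point he hw
    rw [h2.mfderiv_eq, mfderiv_id] at h1
    intro v
    exact ⟨mfderiv 𝓘(ℝ, Coord n × Coord n) (TI n) (point e) z v, (DFunLike.congr_fun h1 v).symm⟩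
  let T : Coord n × Coord n →L[ℝ] Coord n × Coord n := dcoords e q
  have hinj : Function.Injective T.toLinearMap := LinearMap.injective_iff_surjective.2 hsurj
  exact ⟨(LinearEquiv.ofBijective T.toLinearMap ⟨hinj, hsurj⟩).toContinuousLinearEquiv, rfl⟩

/-- The vector field `X` is given by `A` in the coordinates induced by `e`, near `q`. -/
def Represents (e : OpenPartialHomeomorph N (Coord n)) (q : TB n N)
    (X : Π p : TB n N, TangentSpace (TI n) p) (A : Coord n × Coord n → Coord n × Coord n) : Prop :=
  ∀ᶠ q' in 𝓝 q, dcoords e q' (X q') = A (coords e q')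

lemma exists_represents (he : e ∈ IsManifold.maximalAtlas 𝓘(ℝ, Coord n) ∞ N)
    (hq : q.1 ∈ e.source) {X : Π p : TB n N, TangentSpace (TI n) p}
    (hX : SubWeyl.SmoothFieldAt (TI n) X q) :
    ∃ A, ContDiffAt ℝ ∞ A (coords e q) ∧ Represents e q X A := by
  refine ⟨fun z => dcoords e (point e z) (X (point e z)), ?_, ?_⟩
  · have hz := coords_mem_target hq
    have hpq := point_coords he hq
    have hc : ContMDiffOn (TI n) 𝓘(ℝ, Coord n × Coord n) ∞ (coords e)
        {q : TB n N | q.1 ∈ e.source} :=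
      fun q' hq' => (contMDiffAt_coords he hq').contMDiffWithinAt
    have ho := isOpen_preimage_proj (n := n) e.open_source
    have h1 := hc.contMDiffOn_tangentMapWithin (m := ∞) le_rfl ho.uniqueMDiffOn
    have h2 := h1.contMDiffAt (x := ⟨q, X q⟩) ((ho.preimage
      (FiberBundle.continuous_proj _ _)).mem_nhds hq)
    have h3 : ContMDiffAt 𝓘(ℝ, Coord n × Coord n) (TI n).tangent ∞
        ((fun q' => (⟨q', X q'⟩ : TangentBundle (TI n) (TB n N))) ∘ point e) (coords e q) := by
      refine ContMDiffAt.comp _ ?_ (contMDiffAt_point he hz)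
      rw [hpq]
      exact hX
    have h4 := ContMDiffAt.comp_of_eq (x := coords e q) h2 h3
      (congrArg (fun q' => (⟨q', X q'⟩ : TangentBundle (TI n) (TB n N))) hpq)
    have h5 := (contMDiff_snd_tangentBundle_modelSpace (Coord n × Coord n)
      𝓘(ℝ, Coord n × Coord n)).contMDiffAt.comp (coords e q) h4
    refine ContDiffAt.congr_of_eventuallyEq h5.contDiffAt ?_
    filter_upwards [(e.open_target.preimage continuous_fst).mem_nhds hz] with w hw
    simp only [Function.comp, tangentMapWithin, dcoords]
    rw [mfderivWithin_of_mem_nhds (ho.mem_nhds (e.map_target hw))]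
    rfl
  · filter_upwards [eventually_mem_source hq] with q' hq'
    have : ∀ q'' : TB n N, q'' = q' → dcoords e q' (X q') = dcoords e q'' (X q'') := by
      rintro _ rfl; rfl
    exact this _ (point_coords he hq')

lemma Represents.eq {X : Π p : TB n N, TangentSpace (TI n) p}
    {A : Coord n × Coord n → Coord n × Coord n} (h : Represents e q X A) :
    dcoords e q (X q) = A (coords e q) := h.self_of_nhds

/-- In this form the naturality of the Lie bracket under pullback applies. -/
lemma Represents.eventuallyEq_mpullback (he : e ∈ IsManifold.maximalAtlas 𝓘(ℝ, Coord n) ∞ N)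
    (hq : q.1 ∈ e.source) {X : Π p : TB n N, TangentSpace (TI n) p}
    {A : Coord n × Coord n → Coord n × Coord n} (h : Represents e q X A) :
    ∀ᶠ q' in 𝓝 q, X q' = VectorField.mpullback (TI n) 𝓘(ℝ, Coord n × Coord n) (coords e) A q' := by
  filter_upwards [h, eventually_mem_source hq] with q' h1 hq'
  exact ((dcoords_isInvertible he hq').inverse_apply_eq.2 h1.symm).symm

lemma mlieBracket_vectorSpace {Z : Type*} [NormedAddCommGroup Z] [NormedSpace ℝ Z]
    (A B : Π z : Z, TangentSpace 𝓘(ℝ, Z) z) (z : Z) : VectorField.mlieBracket 𝓘(ℝ, Z) A B z =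
      VectorField.lieBracket ℝ A B z := by
  rw [← VectorField.mlieBracketWithin_univ, VectorField.mlieBracketWithin_eq_lieBracketWithin]
  exact congrFun VectorField.lieBracketWithin_univ z

/-- The Lie bracket in induced coordinates. -/
lemma Represents.mlieBracket (he : e ∈ IsManifold.maximalAtlas 𝓘(ℝ, Coord n) ∞ N)
    (hq : q.1 ∈ e.source) {X Y : Π p : TB n N, TangentSpace (TI n) p}
    {A B : Coord n × Coord n → Coord n × Coord n} (hX : Represents e q X A)
    (hY : Represents e q Y B) (hA : ContDiffAt ℝ ∞ A (coords e q))
    (hB : ContDiffAt ℝ ∞ B (coords e q)) :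
    dcoords e q (VectorField.mlieBracket (TI n) X Y q) =
      fderiv ℝ B (coords e q) (A (coords e q)) - fderiv ℝ A (coords e q) (B (coords e q)) := by
  have h2 : minSmoothness ℝ 2 = 2 := minSmoothness_of_isRCLikeNormedField
  have : IsManifold (TI n) (minSmoothness ℝ 2) (TB n N) := by rw [h2]; infer_instance
  have : IsManifold 𝓘(ℝ, Coord n × Coord n) (minSmoothness ℝ 2) (Coord n × Coord n) := by
    rw [h2]; infer_instance
  have hmd : ∀ {A : Coord n × Coord n → Coord n × Coord n}, ContDiffAt ℝ ∞ A (coords e q) →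
      MDifferentiableAt 𝓘(ℝ, Coord n × Coord n) 𝓘(ℝ, Coord n × Coord n).tangent
        (fun z => (⟨z, A z⟩ : TangentBundle 𝓘(ℝ, Coord n × Coord n) (Coord n × Coord n)))
        (coords e q) := fun hA =>
    (contMDiffAt_vectorSpace_iff_contDiffAt.2 hA).mdifferentiableAt (by simp)
  rw [Filter.EventuallyEq.mlieBracket_vectorField_eq (hX.eventuallyEq_mpullback he hq)
    (hY.eventuallyEq_mpullback he hq), ← VectorField.mpullback_mlieBracket (hmd hA) (hmd hB)
    (contMDiffAt_coords he hq) (by rw [h2]; exact two_le_infty)]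
  exact ((dcoords_isInvertible he hq).inverse_apply_eq.1 rfl).symm.trans
    (mlieBracket_vectorSpace A B _)

lemma mlieBracket_eq_zero_of_right {X Y : Π p : TB n N, TangentSpace (TI n) p}
    (hY : ∀ᶠ q' in 𝓝 q, Y q' = 0) : VectorField.mlieBracket (TI n) X Y q = 0 := by
  rw [Filter.EventuallyEq.mlieBracket_vectorField_eq (W := 0) (EventuallyEq.refl _ X) hY,
    VectorField.mlieBracket_zero_right]
  rfl

/-- The derivative along a vector field in induced coordinates. -/
lemma dirDeriv_eq (he : e ∈ IsManifold.maximalAtlas 𝓘(ℝ, Coord n) ∞ N)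
    (hq : q.1 ∈ e.source) (X : Π p : TB n N, TangentSpace (TI n) p) {f : TB n N → ℝ}
    {k : Coord n × Coord n → ℝ} (hf : ∀ᶠ q' in 𝓝 q, f q' = k (coords e q'))
    (hk : DifferentiableAt ℝ k (coords e q)) :
    SubWeyl.dirDeriv (TI n) X f q = fderiv ℝ k (coords e q) (dcoords e q (X q)) := by
  have h1 : f =ᶠ[𝓝 q] k ∘ coords e := hf
  unfold SubWeyl.dirDeriv SubWeyl.diff
  rw [h1.mfderiv_eq, mfderiv_comp q hk.mdifferentiableAt (mdifferentiableAt_coords he hq),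
    mfderiv_eq_fderiv]
  rfl

/-! ### Change of chart -/

lemma contDiffAt_transition (he : e ∈ IsManifold.maximalAtlas 𝓘(ℝ, Coord n) ∞ N)
    (he' : e' ∈ IsManifold.maximalAtlas 𝓘(ℝ, Coord n) ∞ N) {x : Coord n}
    (hx : x ∈ (e.symm.trans e').source) : ContDiffAt ℝ ∞ (e' ∘ e.symm) x := by
  have hx : x ∈ e.target ∧ e.symm x ∈ e'.source := by simpa using hx
  exact ((contMDiffAt_of_mem_maximalAtlas he' hx.2).comp x
    (contMDiffAt_symm_of_mem_maximalAtlas he hx.1)).contDiffAt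

lemma coords_eq_tangentChange (he : e ∈ IsManifold.maximalAtlas 𝓘(ℝ, Coord n) ∞ N)
    (he' : e' ∈ IsManifold.maximalAtlas 𝓘(ℝ, Coord n) ∞ N) (hq : q.1 ∈ e.source)
    (hq' : q.1 ∈ e'.source) : coords e' q = tangentChange (e' ∘ e.symm) (coords e q) := by
  have h0 : e q.1 ∈ (e.symm.trans e').source := by simp [hq, hq']
  have h1 := mfderiv_comp q.1 ((contDiffAt_transition he he' h0).differentiableAt
    (by simp)).mdifferentiableAt ((mdifferentiable_of_mem_maximalAtlas he).mdifferentiableAt hq)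
  have h2 : ((e' ∘ e.symm) ∘ e) =ᶠ[𝓝 q.1] e' := by
    filter_upwards [e.open_source.mem_nhds hq] with x hx
    simp [hx]
  rw [h2.mfderiv_eq, mfderiv_eq_fderiv] at h1
  refine Prod.ext (by simp [coords, tangentChange, hq]) ?_
  exact DFunLike.congr_fun h1 q.2

lemma dcoords_eq_tangentChange (he : e ∈ IsManifold.maximalAtlas 𝓘(ℝ, Coord n) ∞ N)
    (he' : e' ∈ IsManifold.maximalAtlas 𝓘(ℝ, Coord n) ∞ N) (hq : q.1 ∈ e.source)
    (hq' : q.1 ∈ e'.source) (v : TangentSpace (TI n) q) :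
    dcoords e' q v = fderiv ℝ (tangentChange (e' ∘ e.symm)) (coords e q) (dcoords e q v) := by
  have h0 : e q.1 ∈ (e.symm.trans e').source := by simp [hq, hq']
  have h1 := mfderiv_comp q (hasFDerivAt_tangentChange (z := coords e q)
    (contDiffAt_transition he he' h0)).differentiableAt.mdifferentiableAt
    (mdifferentiableAt_coords he hq)
  have h2 : (tangentChange (e' ∘ e.symm) ∘ coords e) =ᶠ[𝓝 q] coords e' := by
    filter_upwards [eventually_mem_source hq, eventually_mem_source hq'] with q' h h'
    exact (coords_eq_tangentChange he he' h h').symm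
  rw [h2.mfderiv_eq, mfderiv_eq_fderiv] at h1
  exact DFunLike.congr_fun h1 v

lemma transition_surjective (he : e ∈ IsManifold.maximalAtlas 𝓘(ℝ, Coord n) ∞ N)
    (he' : e' ∈ IsManifold.maximalAtlas 𝓘(ℝ, Coord n) ∞ N) {x : Coord n}
    (hx : x ∈ (e.symm.trans e').source) :
    Function.Surjective (fderiv ℝ (e' ∘ e.symm) x) := by
  have hx : x ∈ e.target ∧ e.symm x ∈ e'.source := by simpa using hx
  have h1 := mfderiv_comp x ((mdifferentiable_of_mem_maximalAtlas he').mdifferentiableAt hx.2)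
    ((mdifferentiable_of_mem_maximalAtlas he).mdifferentiableAt_symm hx.1)
  rw [mfderiv_eq_fderiv] at h1
  rw [h1]
  exact ((mdifferentiable_of_mem_maximalAtlas he').mfderiv_surjective hx.2).comp
    ((mdifferentiable_of_mem_maximalAtlas he).symm.mfderiv_surjective hx.1)

end Coordinates

/-! ## The Finsler function in induced coordinates -/

section Local

lemma sum_smul_stdB {n : ℕ} (c : Fin n → ℝ) : ∑ i, c i • stdB i = WithLp.toLp 2 c := by
  ext j
  simp [stdB, Finset.sum_apply, Pi.single_apply]

lemma eq_sum_stdB {n : ℕ} (v : Coord n) : v = ∑ i, v i • stdB i := by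
  rw [sum_smul_stdB fun i => v i]

lemma clm_eq_sum {n : ℕ} (T : Coord n →L[ℝ] ℝ) (v : Coord n) : T v = ∑ i, v i * T (stdB i) := by
  conv_lhs => rw [eq_sum_stdB v]
  simp

/-- The restriction of linear forms on `V × V` to the second factor. -/
def vertRestrict (V : Type*) [NormedAddCommGroup V] [NormedSpace ℝ V] :
    (V × V →L[ℝ] ℝ) →L[ℝ] (V →L[ℝ] ℝ) :=
  (ContinuousLinearMap.compL ℝ V (V × V) ℝ).flip (ContinuousLinearMap.inr ℝ V V)

/-- The fibre metric `½ ∂²E/∂y∂y`. -/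
def fibreMetric {V : Type*} [NormedAddCommGroup V] [NormedSpace ℝ V] (E : V × V → ℝ)
    (z : V × V) : V →L[ℝ] V →L[ℝ] ℝ :=
  (1 / 2 : ℝ) • (vertRestrict V).comp ((hess E z).comp (ContinuousLinearMap.inr ℝ V V))

section

variable {V : Type*} [NormedAddCommGroup V] [NormedSpace ℝ V] {E : V × V → ℝ} {U : Set (V × V)}
  {z : V × V}

lemma fibreMetric_apply (E : V × V → ℝ) (z : V × V) (u v : V) :
    fibreMetric E z u v = 1 / 2 * hess E z (0, u) (0, v) := rfl

lemma IsLocalFinsler.differentiableAt_fibreMetric (h : IsLocalFinsler E U) (hz : z ∈ U) :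
    DifferentiableAt ℝ (fibreMetric E) z :=
  ((differentiableAt_const (vertRestrict V)).clm_comp ((h.differentiableAt_hess hz).clm_comp
    (differentiableAt_const (ContinuousLinearMap.inr ℝ V V)))).const_smul (1 / 2 : ℝ)

lemma IsLocalFinsler.fderiv_fibreMetric (h : IsLocalFinsler E U) (hz : z ∈ U) (q : V × V)
    (u v : V) : fderiv ℝ (fibreMetric E) z q u v = 1 / 2 * third E z q (0, u) (0, v) := by
  have h1 := (((hasFDerivAt_const (vertRestrict V) z).clm_comp
    ((h.differentiableAt_hess hz).hasFDerivAt.clm_comp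
      (hasFDerivAt_const (ContinuousLinearMap.inr ℝ V V) z))).const_smul (1 / 2 : ℝ)).fderiv
  have h2 := DFunLike.congr_fun (DFunLike.congr_fun (DFunLike.congr_fun h1 q) u) v
  refine Eq.trans h2 ?_
  simp [vertRestrict]

lemma IsLocalFinsler.fibreMetric_symm (h : IsLocalFinsler E U) (hz : z ∈ U) (u v : V) :
    fibreMetric E z u v = fibreMetric E z v u := by
  rw [fibreMetric_apply, fibreMetric_apply, h.hess_symm hz]

end

variable {n : ℕ} {N : Type*} [TopologicalSpace N] [ChartedSpace (Coord n) N]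
  [IsManifold 𝓘(ℝ, Coord n) ∞ N]

variable {F : TB n N → ℝ} {e e' : OpenPartialHomeomorph N (Coord n)} {q : TB n N}
  {z : Coord n × Coord n} {s : Set (Coord n)}

/-- The nonzero vectors over `s`. -/
def slitOver (s : Set (Coord n)) : Set (Coord n × Coord n) := {z | z.1 ∈ s ∧ z.2 ≠ 0}

lemma isOpen_slitOver (hs : IsOpen s) : IsOpen (slitOver s) :=
  (hs.preimage continuous_fst).inter (isOpen_ne.preimage continuous_snd)

lemma coords_mem_slitOver (he : e ∈ IsManifold.maximalAtlas 𝓘(ℝ, Coord n) ∞ N)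
    (hq : q.1 ∈ e.source) (hq' : q ∈ slit n N) : coords e q ∈ slitOver e.target :=
  ⟨coords_mem_target hq, (coords_ne_zero_iff he hq).2 hq'⟩

/-- The vector of spray coefficients. -/
def sprayVec (F : TB n N → ℝ) (e : OpenPartialHomeomorph N (Coord n)) (z : Coord n × Coord n) :
    Coord n := WithLp.toLp 2 fun a => sprayG F e a z

/-! ### Smoothness, convexity and spray coefficients of the Finsler function -/

lemma contDiffAt_sqF (hF : IsFinsler F) (he : e ∈ IsManifold.maximalAtlas 𝓘(ℝ, Coord n) ∞ N)
    (hz : z ∈ slitOver e.target) : ContDiffAt ℝ ∞ (sqF F e) z := by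
  have h1 := (hF.smooth.contMDiffAt (isOpen_slit.mem_nhds (point_mem_slit he hz.1 hz.2))).comp z
    (contMDiffAt_point he hz.1)
  exact h1.contDiffAt.pow 2

/-- Passes from the iterated scalar derivatives in `pdx` and `pdy` to the form-valued second
derivative `hess`. -/
lemma fderiv_sqF_apply (hF : IsFinsler F) (he : e ∈ IsManifold.maximalAtlas 𝓘(ℝ, Coord n) ∞ N)
    (hz : z ∈ slitOver e.target) (p r : Coord n × Coord n) :
    fderiv ℝ (fun w => fderiv ℝ (sqF F e) w r) z p = hess (sqF F e) z p r := by
  have h := (((contDiffAt_sqF hF he hz).fderiv_right (m := ∞) le_rfl).differentiableAt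
    (by simp)).hasFDerivAt
  rw [(h.clm_apply (hasFDerivAt_const r z)).fderiv]
  simp

lemma gMat_apply (hF : IsFinsler F) (he : e ∈ IsManifold.maximalAtlas 𝓘(ℝ, Coord n) ∞ N)
    (hz : z ∈ slitOver e.target) (b c : Fin n) :
    gMat F e z b c = fibreMetric (sqF F e) z (stdB b) (stdB c) := by
  rw [fibreMetric_apply, ← fderiv_sqF_apply hF he hz]
  rfl

lemma fibreMetric_eq_sum (hF : IsFinsler F) (he : e ∈ IsManifold.maximalAtlas 𝓘(ℝ, Coord n) ∞ N)
    (hz : z ∈ slitOver e.target) (u v : Coord n) :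
    fibreMetric (sqF F e) z u v = ∑ b, ∑ c, gMat F e z b c * (u b * v c) := by
  conv_lhs => rw [eq_sum_stdB u]
  simp only [map_sum, map_smul, sum_apply, smul_apply, smul_eq_mul]
  refine Finset.sum_congr rfl fun b _ => ?_
  rw [clm_eq_sum, Finset.mul_sum]
  refine Finset.sum_congr rfl fun c _ => ?_
  rw [gMat_apply hF he hz]
  ring

lemma posDef_gMat (hF : IsFinsler F) (he : e ∈ IsManifold.maximalAtlas 𝓘(ℝ, Coord n) ∞ N)
    (hz : z ∈ slitOver e.target) : (gMat F e z).PosDef := by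
  have := hF.posDef e he (point e z) (point_mem_slit he hz.1 hz.2) (e.map_target hz.1)
  rwa [coords_point he hz.1] at this

lemma sqF_homogeneous (hF : IsFinsler F) (z : Coord n × Coord n) {c : ℝ} (hc : 0 < c) :
    sqF F e (z.1, c • z.2) = c ^ 2 * sqF F e z := by
  have h1 : (point e (z.1, c • z.2) : TB n N) = ⟨e.symm z.1,
      c • mfderiv 𝓘(ℝ, Coord n) 𝓘(ℝ, Coord n) e.symm z.1 z.2⟩ :=
    congrArg (Bundle.TotalSpace.mk _) (map_smul _ c z.2)
  unfold sqF
  rw [h1, hF.homogeneous _ _ c hc, mul_pow]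
  rfl

/-- The freedom in `s` allows restriction to the overlap of two charts. -/
lemma isLocalFinsler (hF : IsFinsler F) (he : e ∈ IsManifold.maximalAtlas 𝓘(ℝ, Coord n) ∞ N)
    (hs : IsOpen s) (hse : s ⊆ e.target) : IsLocalFinsler (sqF F e) (slitOver s) where
  isOpen := isOpen_slitOver hs
  smooth := fun z hz => (contDiffAt_sqF hF he ⟨hse hz.1, hz.2⟩).contDiffWithinAt
  homog := fun z hz c hc => ⟨⟨hz.1, smul_ne_zero hc.ne' hz.2⟩, sqF_homogeneous hF z hc⟩
  pos := by
    intro z hz v hv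
    have hz' : z ∈ slitOver e.target := ⟨hse hz.1, hz.2⟩
    have hv' : (fun i => v i) ≠ 0 := fun h => hv (by ext i; exact congrFun h i)
    have h1 := (posDef_gMat hF he hz').dotProduct_mulVec_pos hv'
    have h2 : dotProduct (star fun i => v i) (Matrix.mulVec (gMat F e z) fun i => v i) =
        fibreMetric (sqF F e) z v v := by
      rw [fibreMetric_eq_sum hF he hz']
      simp only [dotProduct, Matrix.mulVec, Finset.mul_sum, Pi.star_apply, star_trivial]
      exact Finset.sum_congr rfl fun b _ => Finset.sum_congr rfl fun c _ => by ring
    rw [h2, fibreMetric_apply] at h1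
    linarith

lemma contDiffAt_det {Z : Type*} [NormedAddCommGroup Z] [NormedSpace ℝ Z] {m : ℕ}
    {M : Z → Matrix (Fin m) (Fin m) ℝ} {z : Z} (hM : ∀ i j, ContDiffAt ℝ ∞ (fun w => M w i j) z) :
    ContDiffAt ℝ ∞ (fun w => (M w).det) z := by
  simp only [Matrix.det_apply]
  refine ContDiffAt.sum fun σ _ => ?_
  refine ContDiffAt.const_smul _ ?_
  exact contDiffAt_prod fun i _ => hM _ _

/-- Cramer's rule: the entries are determinants divided by a nonvanishing determinant. -/
lemma contDiffAt_inv_apply {Z : Type*} [NormedAddCommGroup Z] [NormedSpace ℝ Z] {m : ℕ}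
    {M : Z → Matrix (Fin m) (Fin m) ℝ} {z : Z} (hM : ∀ i j, ContDiffAt ℝ ∞ (fun w => M w i j) z)
    (hdet : (M z).det ≠ 0) (i j : Fin m) : ContDiffAt ℝ ∞ (fun w => (M w)⁻¹ i j) z := by
  simp only [Matrix.inv_def, Matrix.smul_apply, Ring.inverse_eq_inv', Matrix.adjugate_apply,
    smul_eq_mul]
  refine ((contDiffAt_det hM).inv hdet).mul (contDiffAt_det fun k l => ?_)
  simp only [Matrix.updateRow_apply]
  split_ifs
  · exact contDiffAt_const
  · exact hM k l

lemma contDiffAt_gMat (hF : IsFinsler F) (he : e ∈ IsManifold.maximalAtlas 𝓘(ℝ, Coord n) ∞ N)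
    (hz : z ∈ slitOver e.target) (b c : Fin n) : ContDiffAt ℝ ∞ (fun w => gMat F e w b c) z := by
  have h1 := (((contDiffAt_sqF hF he hz).fderiv_right (m := ∞) le_rfl).clm_apply
    (contDiffAt_const (c := ((0 : Coord n), stdB c)))).fderiv_right (m := ∞) le_rfl
  exact contDiffAt_const.mul (h1.clm_apply contDiffAt_const)

lemma contDiffAt_sprayVec (hF : IsFinsler F) (he : e ∈ IsManifold.maximalAtlas 𝓘(ℝ, Coord n) ∞ N)
    (hz : z ∈ slitOver e.target) : ContDiffAt ℝ ∞ (sprayVec F e) z := by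
  refine contDiffAt_piLp' 2 fun a => ?_
  have hE := (contDiffAt_sqF hF he hz).fderiv_right (m := ∞) le_rfl
  have hx : ∀ b, ContDiffAt ℝ ∞ (fun w => fderiv ℝ (sqF F e) w (stdB b, 0)) z :=
    fun b => hE.clm_apply contDiffAt_const
  have hdet : (gMat F e z).det ≠ 0 := (posDef_gMat hF he hz).det_pos.ne'
  refine contDiffAt_const.mul (ContDiffAt.sum fun b _ => ?_)
  refine (contDiffAt_inv_apply (contDiffAt_gMat hF he hz) hdet a b).mul ?_
  refine (ContDiffAt.sum fun c _ => ?_).sub (hx b)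
  refine (((hx c).fderiv_right (m := ∞) le_rfl).clm_apply contDiffAt_const).mul ?_
  exact (EuclideanSpace.proj c : Coord n →L[ℝ] ℝ).contDiff.contDiffAt.comp z contDiffAt_snd

/-- Lowering the index of `G^a` removes the inverse matrix: `g_{ba} G^a = ¼ R_b`, and `g` is half
the vertical Hessian. -/
lemma euler_lagrange (hF : IsFinsler F) (he : e ∈ IsManifold.maximalAtlas 𝓘(ℝ, Coord n) ∞ N)
    (hz : z ∈ slitOver e.target) (v : Coord n) :
    2 * hess (sqF F e) z (0, v) (0, sprayVec F e z) =
      hess (sqF F e) z (0, v) (z.2, 0) - fderiv ℝ (sqF F e) z (v, 0) := by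
  set R : Fin n → ℝ := fun b => (∑ c, pdy b (pdx c (sqF F e)) z * z.2 c) - pdx b (sqF F e) z with hR
  have hRb : ∀ b, R b = hess (sqF F e) z (0, stdB b) (z.2, 0)
      - fderiv ℝ (sqF F e) z (stdB b, 0) := by
    intro b
    have h1 := clm_eq_sum ((hess (sqF F e) z (0, stdB b)).comp
      (ContinuousLinearMap.inl ℝ (Coord n) (Coord n))) z.2
    simp only [ContinuousLinearMap.comp_apply, ContinuousLinearMap.inl_apply] at h1
    rw [h1, hR]
    refine congrArg₂ _ (Finset.sum_congr rfl fun c _ => ?_) rfl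
    rw [← fderiv_sqF_apply hF he hz, mul_comm]
    rfl
  have hG : ∀ a, sprayVec F e z a = 1 / 4 * (Matrix.mulVec (gMat F e z)⁻¹ R) a := fun a => rfl
  have hgG : ∀ b, fibreMetric (sqF F e) z (stdB b) (sprayVec F e z) = 1 / 4 * R b := by
    intro b
    rw [clm_eq_sum]
    have h1 : Matrix.mulVec (gMat F e z) (Matrix.mulVec (gMat F e z)⁻¹ R) = R := by
      rw [Matrix.mulVec_mulVec, Matrix.mul_nonsing_inv, Matrix.one_mulVec]
      exact (posDef_gMat hF he hz).det_pos.ne'.isUnit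
    have h2 := congrFun h1 b
    rw [← h2, Matrix.mulVec, dotProduct, Finset.mul_sum]
    refine Finset.sum_congr rfl fun a _ => ?_
    rw [hG, gMat_apply hF he hz]
    ring
  have hb : ∀ b, 2 * hess (sqF F e) z (0, stdB b) (0, sprayVec F e z) =
      hess (sqF F e) z (0, stdB b) (z.2, 0) - fderiv ℝ (sqF F e) z (stdB b, 0) := by
    intro b
    rw [← hRb]
    have := hgG b
    rw [fibreMetric_apply] at this
    linarith
  let T : Coord n →L[ℝ] ℝ := (2 : ℝ) • (((hess (sqF F e) z).flip (0, sprayVec F e z)).comp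
    (ContinuousLinearMap.inr ℝ (Coord n) (Coord n)))
  let S : Coord n →L[ℝ] ℝ := ((hess (sqF F e) z).flip (z.2, 0)).comp
    (ContinuousLinearMap.inr ℝ (Coord n) (Coord n)) - (fderiv ℝ (sqF F e) z).comp
    (ContinuousLinearMap.inl ℝ (Coord n) (Coord n))
  have hT : T v = S v := by
    rw [clm_eq_sum T, clm_eq_sum S]
    exact Finset.sum_congr rfl fun b _ => congrArg _ (hb b)
  exact hT

lemma isSprayOn (hF : IsFinsler F) (he : e ∈ IsManifold.maximalAtlas 𝓘(ℝ, Coord n) ∞ N)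
    (hs : IsOpen s) (hse : s ⊆ e.target) :
    IsSprayOn (sqF F e) (sprayVec F e) (slitOver s) where
  toIsLocalFinsler := isLocalFinsler hF he hs hse
  smoothG := fun _ hz => contDiffAt_sprayVec hF he ⟨hse hz.1, hz.2⟩
  eulerLagrange := fun _ hz => euler_lagrange hF he ⟨hse hz.1, hz.2⟩

lemma isSprayOn_target (hF : IsFinsler F)
    (he : e ∈ IsManifold.maximalAtlas 𝓘(ℝ, Coord n) ∞ N) :
    IsSprayOn (sqF F e) (sprayVec F e) (slitOver e.target) :=
  isSprayOn hF he e.open_target subset_rfl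

lemma nlc_eq (hF : IsFinsler F) (he : e ∈ IsManifold.maximalAtlas 𝓘(ℝ, Coord n) ∞ N)
    (hz : z ∈ slitOver e.target) (a b : Fin n) :
    nlc F e a b z = nonlin (sprayVec F e) z (stdB b) a := by
  have h1 := ((EuclideanSpace.proj a : Coord n →L[ℝ] ℝ).hasFDerivAt).comp z
    ((isSprayOn_target hF he).hasFDerivAt_spray hz)
  have h2 := DFunLike.congr_fun h1.fderiv (0, stdB b)
  exact h2

/-! ### The geometric objects in induced coordinates -/

/-- The vertical component of a vector. -/
def vpart (G : Coord n × Coord n → Coord n) (z : Coord n × Coord n) :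
    Coord n × Coord n →L[ℝ] Coord n :=
  ContinuousLinearMap.snd ℝ _ _ + (nonlin G z).comp (ContinuousLinearMap.fst ℝ _ _)

lemma vpart_apply (G : Coord n × Coord n → Coord n) (z w : Coord n × Coord n) :
    vpart G z w = w.2 + nonlin G z w.1 := rfl

lemma hlift_add_vpart (G : Coord n × Coord n → Coord n) (z w : Coord n × Coord n) :
    hlift G z w.1 + (0, vpart G z w) = w := by
  refine Prod.ext ?_ ?_ <;> simp [hlift, vpart_apply]

lemma vpart_vert (G : Coord n × Coord n → Coord n) (z : Coord n × Coord n) (v : Coord n) :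
    vpart G z (0, v) = v := by
  simp [vpart_apply]

lemma vpart_hlift (G : Coord n × Coord n → Coord n) (z : Coord n × Coord n) (v : Coord n) :
    vpart G z (hlift G z v) = 0 := by
  simp [hlift, vpart_apply]

lemma dx_apply (a : Fin n) (v : TangentSpace (TI n) q) : dx e a q v = (dcoords e q v).1 a := rfl

lemma deltaY_apply (hF : IsFinsler F) (he : e ∈ IsManifold.maximalAtlas 𝓘(ℝ, Coord n) ∞ N)
    (hq : q.1 ∈ e.source) (hq' : q ∈ slit n N) (a : Fin n) (v : TangentSpace (TI n) q) :
    deltaY F e a q v = vpart (sprayVec F e) (coords e q) (dcoords e q v) a := by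
  have hz := coords_mem_slitOver he hq hq'
  have h1 : deltaY F e a q v = (dcoords e q v).2 a +
      ∑ b, nlc F e a b (coords e q) * (dcoords e q v).1 b := by
    unfold deltaY
    rw [add_apply, sum_apply]
    rfl
  rw [h1, vpart_apply, PiLp.add_apply]
  congr 1
  have h2 := clm_eq_sum ((EuclideanSpace.proj a : Coord n →L[ℝ] ℝ).comp
    (nonlin (sprayVec F e) (coords e q))) (dcoords e q v).1
  refine Eq.trans ?_ h2.symm
  refine Finset.sum_congr rfl fun b _ => ?_
  rw [nlc_eq hF he hz, mul_comm]
  rfl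

lemma dcoords_injective (he : e ∈ IsManifold.maximalAtlas 𝓘(ℝ, Coord n) ∞ N)
    (hq : q.1 ∈ e.source) : Function.Injective (dcoords e q) :=
  (dcoords_isInvertible he hq).injective

lemma dcoords_inverse (he : e ∈ IsManifold.maximalAtlas 𝓘(ℝ, Coord n) ∞ N)
    (hq : q.1 ∈ e.source) (w : Coord n × Coord n) :
    dcoords e q ((dcoords e q).inverse w) = w :=
  ContinuousLinearMap.IsInvertible.self_apply_inverse (dcoords_isInvertible he hq) w

lemma dcoords_dDy (he : e ∈ IsManifold.maximalAtlas 𝓘(ℝ, Coord n) ∞ N)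
    (hq : q.1 ∈ e.source) (a : Fin n) : dcoords e q (dDy e a q) = (0, stdB a) :=
  dcoords_inverse he hq _

lemma dcoords_deltaX (hF : IsFinsler F) (he : e ∈ IsManifold.maximalAtlas 𝓘(ℝ, Coord n) ∞ N)
    (hq : q.1 ∈ e.source) (hq' : q ∈ slit n N) (a : Fin n) :
    dcoords e q (deltaX F e a q) = hlift (sprayVec F e) (coords e q) (stdB a) := by
  have h1 : dcoords e q (dDx e a q) = (stdB a, 0) := dcoords_inverse he hq _
  unfold deltaX
  rw [map_sub, map_sum, h1]
  simp only [map_smul, dcoords_dDy he hq, nlc_eq hF he (coords_mem_slitOver he hq hq')]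
  have h2 := eq_sum_stdB (nonlin (sprayVec F e) (coords e q) (stdB a))
  have h3 := congrArg (ContinuousLinearMap.inr ℝ (Coord n) (Coord n)) h2
  simp only [map_sum, map_smul, ContinuousLinearMap.inr_apply] at h3
  rw [← h3]
  simp [hlift]

lemma dcoords_sum_dDy (he : e ∈ IsManifold.maximalAtlas 𝓘(ℝ, Coord n) ∞ N)
    (hq : q.1 ∈ e.source) (c : Fin n → ℝ) :
    dcoords e q (∑ i, c i • dDy e i q) = (0, WithLp.toLp 2 c) := by
  simp only [map_sum, map_smul, dcoords_dDy he hq]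
  have h3 := congrArg (ContinuousLinearMap.inr ℝ (Coord n) (Coord n)) (sum_smul_stdB c)
  simpa only [map_sum, map_smul, ContinuousLinearMap.inr_apply] using h3

/-- The horizontal lift, as a linear map. -/
def hliftL (G : Coord n × Coord n → Coord n) (z : Coord n × Coord n) :
    Coord n →L[ℝ] Coord n × Coord n := (ContinuousLinearMap.id ℝ _).prod (-nonlin G z)

lemma hliftL_apply (G : Coord n × Coord n → Coord n) (z : Coord n × Coord n) (v : Coord n) :
    hliftL G z v = hlift G z v := rfl

lemma dcoords_sum_deltaX (hF : IsFinsler F) (he : e ∈ IsManifold.maximalAtlas 𝓘(ℝ, Coord n) ∞ N)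
    (hq : q.1 ∈ e.source) (hq' : q ∈ slit n N) (c : Fin n → ℝ) :
    dcoords e q (∑ i, c i • deltaX F e i q) =
      hlift (sprayVec F e) (coords e q) (WithLp.toLp 2 c) := by
  simp only [map_sum, map_smul, dcoords_deltaX hF he hq hq']
  have h3 := congrArg (hliftL (sprayVec F e) (coords e q)) (sum_smul_stdB c)
  simpa only [map_sum, map_smul, hliftL_apply] using h3

/-- Both functions are `F²` read at the same point of `TN`. -/
lemma isChange (he : e ∈ IsManifold.maximalAtlas 𝓘(ℝ, Coord n) ∞ N)
    (he' : e' ∈ IsManifold.maximalAtlas 𝓘(ℝ, Coord n) ∞ N) :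
    IsChange (e' ∘ e.symm) (sqF F e) (slitOver (e.symm.trans e').source) (sqF F e')
      (slitOver e'.target) := by
  have key : ∀ z ∈ slitOver (e.symm.trans e').source,
      (point e z : TB n N).1 ∈ e'.source ∧ (point e z : TB n N) ∈ slit n N ∧
        tangentChange (e' ∘ e.symm) z = coords e' (point e z : TB n N) := by
    intro z hz
    have h : z.1 ∈ e.target ∧ e.symm z.1 ∈ e'.source := by simpa using hz.1
    refine ⟨h.2, point_mem_slit he h.1 hz.2, ?_⟩
    rw [coords_eq_tangentChange he he' (e.map_target h.1) h.2, coords_point he h.1]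
  refine ⟨isOpen_slitOver (e.symm.trans e').open_source, fun z hz => ?_, fun z hz => ?_,
    fun z hz => ?_⟩
  · rw [(key z hz).2.2]
    exact coords_mem_slitOver he' (key z hz).1 (key z hz).2.1
  · exact contDiffAt_transition he he' hz.1
  · unfold sqF
    rw [(key z hz).2.2, point_coords he' (key z hz).1]

/-- The components of a vector transform linearly under a change of chart. -/
lemma change_components (hF : IsFinsler F) (he : e ∈ IsManifold.maximalAtlas 𝓘(ℝ, Coord n) ∞ N)
    (he' : e' ∈ IsManifold.maximalAtlas 𝓘(ℝ, Coord n) ∞ N) (hq : q.1 ∈ e.source)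
    (hq' : q.1 ∈ e'.source) (hqs : q ∈ slit n N) :
    ∃ A : Coord n →L[ℝ] Coord n, A (coords e q).2 = (coords e' q).2 ∧
      (∀ v : TangentSpace (TI n) q, (dcoords e' q v).1 = A (dcoords e q v).1 ∧
        vpart (sprayVec F e') (coords e' q) (dcoords e' q v) =
          A (vpart (sprayVec F e) (coords e q) (dcoords e q v))) ∧
      ∀ u v, fibreMetric (sqF F e') (coords e' q) (A u) (A v) =
        fibreMetric (sqF F e) (coords e q) u v := by
  have hc := isChange (F := F) he he'
  have h0 : (coords e q).1 ∈ (e.symm.trans e').source := by simp [coords, hq, hq']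
  have hz : coords e q ∈ slitOver (e.symm.trans e').source :=
    ⟨h0, (coords_ne_zero_iff he hq).2 hqs⟩
  have hS := isSprayOn hF he (e.symm.trans e').open_source (by
    intro x hx
    have : x ∈ e.target ∧ e.symm x ∈ e'.source := by simpa using hx
    exact this.1)
  have hS' := isSprayOn_target hF he'
  have hcoord := coords_eq_tangentChange he he' hq hq'
  have hφ := hc.smooth _ hz
  refine ⟨fderiv ℝ (e' ∘ e.symm) (coords e q).1, ?_, fun v => ?_, fun u v => ?_⟩
  · rw [hcoord]; rfl
  · have h1 := dcoords_eq_tangentChange he he' hq hq' v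
    -- The vector is split into its horizontal and vertical parts; the change of coordinates
    -- preserves the splitting and acts on each component by `Dφ`.
    have h2 := hc.fderiv_hlift hS hS' (fun w hw => transition_surjective he he' hw.1) hz
      (dcoords e q v).1
    have h3 := fderiv_tangentChange hφ (0, vpart (sprayVec F e) (coords e q) (dcoords e q v))
    simp only [map_zero, _root_.zero_apply, add_zero] at h3
    rw [← hlift_add_vpart (sprayVec F e) (coords e q) (dcoords e q v), map_add, h2, h3,
      ← hcoord] at h1
    rw [h1, map_add, vpart_hlift]
    exact ⟨by simp [hlift], by simp [vpart_apply]⟩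
  · have h1 := hc.hess_eq hS.toIsLocalFinsler hS'.toIsLocalFinsler hz (0, u) v
    rw [fderiv_tangentChange hφ] at h1
    simp only [map_zero, _root_.zero_apply, add_zero] at h1
    rw [fibreMetric_apply, fibreMetric_apply, h1, hcoord]
    erw [map_zero]
    rw [add_zero]

/-! ### From the preferred chart to an arbitrary chart -/

lemma pchart_mem (q : TB n N) : pchart q ∈ IsManifold.maximalAtlas 𝓘(ℝ, Coord n) ∞ N :=
  IsManifold.chart_mem_maximalAtlas (I := 𝓘(ℝ, Coord n)) (n := ∞) q.1

lemma mem_pchart_source (q : TB n N) : q.1 ∈ (pchart q).source := mem_chart_source (Coord n) q.1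

/-- Equality of vectors can be tested on components. -/
lemma eq_iff_components {G : Coord n × Coord n → Coord n} {z w w' : Coord n × Coord n} :
    w = w' ↔ w.1 = w'.1 ∧ vpart G z w = vpart G z w' := by
  refine ⟨fun h => by simp [h], fun h => ?_⟩
  rw [← hlift_add_vpart G z w, ← hlift_add_vpart G z w', h.1, h.2]

lemma vertP_eq_sum (q : TB n N) (v : TangentSpace (TI n) q) :
    vertP F q v = ∑ i, deltaY F (pchart q) i q v • dDy (pchart q) i q := by
  unfold vertP
  rw [sum_apply]
  rfl

lemma horP_eq_sum (q : TB n N) (v : TangentSpace (TI n) q) :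
    horP F q v = ∑ i, dx (pchart q) i q v • deltaX F (pchart q) i q := by
  unfold horP
  rw [sum_apply]
  rfl

lemma adjointStr_eq_sum (q : TB n N) (v : TangentSpace (TI n) q) :
    adjointStr F q v = ∑ i, deltaY F (pchart q) i q v • deltaX F (pchart q) i q := by
  unfold adjointStr
  rw [sum_apply]
  rfl

lemma dcoords_vertP (hF : IsFinsler F) (he : e ∈ IsManifold.maximalAtlas 𝓘(ℝ, Coord n) ∞ N)
    (hq : q.1 ∈ e.source) (hqs : q ∈ slit n N)
    (v : TangentSpace (TI n) q) : dcoords e q (vertP F q v) =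
      (0, vpart (sprayVec F e) (coords e q) (dcoords e q v)) := by
  obtain ⟨A, -, hA, -⟩ := change_components hF (pchart_mem q) he (mem_pchart_source q) hq hqs
  have h0 : dcoords (pchart q) q (vertP F q v) =
      (0, vpart (sprayVec F (pchart q)) (coords (pchart q) q) (dcoords (pchart q) q v)) := by
    rw [vertP_eq_sum, dcoords_sum_dDy (pchart_mem q) (mem_pchart_source q)]
    simp only [deltaY_apply hF (pchart_mem q) (mem_pchart_source q) hqs]
  rw [eq_iff_components (G := sprayVec F e) (z := coords e q), (hA (vertP F q v)).1,
    (hA (vertP F q v)).2, h0, (hA v).2, vpart_vert, vpart_vert]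
  exact ⟨map_zero A, rfl⟩

lemma dcoords_horP (hF : IsFinsler F) (he : e ∈ IsManifold.maximalAtlas 𝓘(ℝ, Coord n) ∞ N)
    (hq : q.1 ∈ e.source) (hqs : q ∈ slit n N)
    (v : TangentSpace (TI n) q) : dcoords e q (horP F q v) =
      hlift (sprayVec F e) (coords e q) (dcoords e q v).1 := by
  obtain ⟨A, -, hA, -⟩ := change_components hF (pchart_mem q) he (mem_pchart_source q) hq hqs
  have h0 : dcoords (pchart q) q (horP F q v) =
      hlift (sprayVec F (pchart q)) (coords (pchart q) q) (dcoords (pchart q) q v).1 := by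
    rw [horP_eq_sum, dcoords_sum_deltaX hF (pchart_mem q) (mem_pchart_source q) hqs]
    simp only [dx_apply]
  rw [eq_iff_components (G := sprayVec F e) (z := coords e q), (hA (horP F q v)).1,
    (hA (horP F q v)).2, h0, vpart_hlift, vpart_hlift, map_zero]
  exact ⟨(hA v).1.symm, rfl⟩

lemma dcoords_liouville (hF : IsFinsler F) (he : e ∈ IsManifold.maximalAtlas 𝓘(ℝ, Coord n) ∞ N)
    (hq : q.1 ∈ e.source) (hqs : q ∈ slit n N) :
    dcoords e q (liouville q) = (0, (coords e q).2) := by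
  obtain ⟨A, hy, hA, -⟩ := change_components hF (pchart_mem q) he (mem_pchart_source q) hq hqs
  have h0 : dcoords (pchart q) q (liouville q) = (0, (coords (pchart q) q).2) := by
    unfold liouville
    rw [dcoords_sum_dDy (pchart_mem q) (mem_pchart_source q)]
  rw [eq_iff_components (G := sprayVec F e) (z := coords e q), (hA (liouville q)).1,
    (hA (liouville q)).2, h0, vpart_apply, vpart_apply]
  simp [hy]

lemma dcoords_geoSpray (hF : IsFinsler F) (he : e ∈ IsManifold.maximalAtlas 𝓘(ℝ, Coord n) ∞ N)
    (hq : q.1 ∈ e.source) (hqs : q ∈ slit n N) :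
    dcoords e q (geoSpray F q) = hlift (sprayVec F e) (coords e q) (coords e q).2 := by
  obtain ⟨A, hy, hA, -⟩ := change_components hF (pchart_mem q) he (mem_pchart_source q) hq hqs
  have h0 : dcoords (pchart q) q (geoSpray F q) =
      hlift (sprayVec F (pchart q)) (coords (pchart q) q) (coords (pchart q) q).2 := by
    unfold geoSpray
    rw [dcoords_sum_deltaX hF (pchart_mem q) (mem_pchart_source q) hqs]
  rw [eq_iff_components (G := sprayVec F e) (z := coords e q), (hA (geoSpray F q)).1,
    (hA (geoSpray F q)).2, h0, vpart_hlift, vpart_hlift, map_zero]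
  exact ⟨hy, rfl⟩

lemma sasaki_eq (hF : IsFinsler F) (he : e ∈ IsManifold.maximalAtlas 𝓘(ℝ, Coord n) ∞ N)
    (hq : q.1 ∈ e.source) (hqs : q ∈ slit n N)
    (v w : TangentSpace (TI n) q) : sasaki F q v w =
      fibreMetric (sqF F e) (coords e q) (dcoords e q v).1 (dcoords e q w).1 +
      fibreMetric (sqF F e) (coords e q) (vpart (sprayVec F e) (coords e q) (dcoords e q v))
        (vpart (sprayVec F e) (coords e q) (dcoords e q w)) := by
  obtain ⟨A, -, hA, hg⟩ := change_components hF (pchart_mem q) he (mem_pchart_source q) hq hqs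
  rw [(hA v).1, (hA v).2, (hA w).1, (hA w).2, hg, hg]
  have hz := coords_mem_slitOver (pchart_mem q) (mem_pchart_source q) hqs
  rw [fibreMetric_eq_sum hF (pchart_mem q) hz, fibreMetric_eq_sum hF (pchart_mem q) hz,
    ← Finset.sum_add_distrib]
  refine Finset.sum_congr rfl fun a _ => ?_
  rw [← Finset.sum_add_distrib]
  refine Finset.sum_congr rfl fun b _ => ?_
  rw [deltaY_apply hF (pchart_mem q) (mem_pchart_source q) hqs,
    deltaY_apply hF (pchart_mem q) (mem_pchart_source q) hqs, dx_apply, dx_apply]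
  ring

/-- The differentiated Euler relation says `½ ∂E/∂y^a = g_{ab} y^b`. -/
lemma cartanForm_eq (hF : IsFinsler F) (he : e ∈ IsManifold.maximalAtlas 𝓘(ℝ, Coord n) ∞ N)
    (hq : q.1 ∈ e.source) (hqs : q ∈ slit n N)
    (v : TangentSpace (TI n) q) : cartanForm F q v =
      fibreMetric (sqF F e) (coords e q) (coords e q).2 (dcoords e q v).1 := by
  obtain ⟨A, hy, hA, hg⟩ := change_components hF (pchart_mem q) he (mem_pchart_source q) hq hqs
  have hz := coords_mem_slitOver (pchart_mem q) (mem_pchart_source q) hqs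
  have hS := isSprayOn_target hF (pchart_mem q)
  rw [(hA v).1, ← hy, hg, hS.fibreMetric_symm hz, fibreMetric_apply]
  have h1 := hS.hess_vert hz (0, (dcoords (pchart q) q v).1)
  simp only at h1
  have h2 := clm_eq_sum ((fderiv ℝ (sqF F (pchart q)) (coords (pchart q) q)).comp
    (ContinuousLinearMap.inr ℝ (Coord n) (Coord n))) (dcoords (pchart q) q v).1
  simp only [ContinuousLinearMap.comp_apply, ContinuousLinearMap.inr_apply] at h2
  have h3 : cartanForm F q v = 1 / 2 * fderiv ℝ (sqF F (pchart q)) (coords (pchart q) q)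
      (0, (dcoords (pchart q) q v).1) := by
    unfold cartanForm
    rw [sum_apply, h2, Finset.mul_sum]
    refine Finset.sum_congr rfl fun a _ => ?_
    rw [smul_apply, dx_apply, smul_eq_mul]
    unfold pdy
    ring
  linarith

lemma sq_eq_fibreMetric (hF : IsFinsler F) (he : e ∈ IsManifold.maximalAtlas 𝓘(ℝ, Coord n) ∞ N)
    (hq : q.1 ∈ e.source) (hqs : q ∈ slit n N) :
    F q ^ 2 = fibreMetric (sqF F e) (coords e q) (coords e q).2 (coords e q).2 := by
  have hz := coords_mem_slitOver he hq hqs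
  have hS := isSprayOn_target hF he
  have h1 := hS.hess_vert hz (0, (coords e q).2)
  have h2 := hS.fderiv_vert hz
  have h3 : sqF F e (coords e q) = F q ^ 2 := by
    unfold sqF
    rw [point_coords he hq]
  rw [fibreMetric_apply, ← h3]
  simp only at h1
  linarith

end Local

/-! ## The intrinsic Weyl connections in induced coordinates -/

section Connections

variable {n : ℕ} {N : Type*} [TopologicalSpace N] [ChartedSpace (Coord n) N]
  [IsManifold 𝓘(ℝ, Coord n) ∞ N]

variable {F : TB n N → ℝ} {e : OpenPartialHomeomorph N (Coord n)} {p : TB n N}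

/-- Near `p`, the distribution with projector `Q` is parametrized by `lift`, with the components of
vectors given by `comp`; the parametrization is isometric and compatible with brackets. -/
structure IsAdaptedFrame (F : TB n N → ℝ) (e : OpenPartialHomeomorph N (Coord n)) (p : TB n N)
    (Q : Π q : TB n N, TangentSpace (TI n) q →L[ℝ] TangentSpace (TI n) q)
    (lift : Coord n × Coord n → Coord n →L[ℝ] Coord n × Coord n)
    (comp : Coord n × Coord n → Coord n × Coord n →L[ℝ] Coord n) : Prop where
  smooth_lift : ContDiffAt ℝ ∞ lift (coords e p)
  smooth_comp : ContDiffAt ℝ ∞ comp (coords e p)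
  comp_lift : ∀ v, comp (coords e p) (lift (coords e p) v) = v
  proj : ∀ᶠ q in 𝓝 p, ∀ v, dcoords e q (Q q v) =
    lift (coords e q) (comp (coords e q) (dcoords e q v))
  metric : ∀ᶠ q in 𝓝 p, ∀ v w b c, dcoords e q v = lift (coords e q) b →
    dcoords e q w = lift (coords e q) c →
      sasaki F q v w = fibreMetric (sqF F e) (coords e q) b c
  bracket : ∀ a b : Coord n × Coord n → Coord n, ContDiffAt ℝ ∞ a (coords e p) →
    ContDiffAt ℝ ∞ b (coords e p) →
      comp (coords e p)
        (fderiv ℝ (fun w => lift w (b w)) (coords e p) (lift (coords e p) (a (coords e p)))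
          - fderiv ℝ (fun w => lift w (a w)) (coords e p) (lift (coords e p) (b (coords e p)))) =
        fderiv ℝ b (coords e p) (lift (coords e p) (a (coords e p)))
          - fderiv ℝ a (coords e p) (lift (coords e p) (b (coords e p)))

lemma eventually_slit_source (hp : p.1 ∈ e.source) (hps : p ∈ slit n N) :
    ∀ᶠ q in 𝓝 p, q.1 ∈ e.source ∧ q ∈ slit n N :=
  (eventually_mem_source hp).and (isOpen_slit.mem_nhds hps)

lemma fderiv_inr {a : Coord n × Coord n → Coord n} {z : Coord n × Coord n}
    (ha : DifferentiableAt ℝ a z) (D : Coord n × Coord n) :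
    fderiv ℝ (fun w => ContinuousLinearMap.inr ℝ (Coord n) (Coord n) (a w)) z D =
      (0, fderiv ℝ a z D) :=
  DFunLike.congr_fun ((ContinuousLinearMap.inr ℝ (Coord n) (Coord n)).hasFDerivAt.comp z
    ha.hasFDerivAt).fderiv D

/-- The vertical lift is constant in coordinates, so brackets only differentiate components. -/
lemma isAdaptedFrame_vert (hF : IsFinsler F)
    (he : e ∈ IsManifold.maximalAtlas 𝓘(ℝ, Coord n) ∞ N) (hp : p.1 ∈ e.source)
    (hps : p ∈ slit n N) :
    IsAdaptedFrame F e p (vertP F) (fun _ => ContinuousLinearMap.inr ℝ _ _)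
      (vpart (sprayVec F e)) where
  smooth_lift := contDiffAt_const
  smooth_comp := contDiffAt_const.add
    (((isSprayOn_target hF he).contDiffAt_nonlin (coords_mem_slitOver he hp hps)).clm_comp
      contDiffAt_const)
  comp_lift := fun v => vpart_vert _ _ v
  proj := by
    filter_upwards [eventually_slit_source hp hps] with q hq v using dcoords_vertP hF he hq.1 hq.2 v
  metric := by
    filter_upwards [eventually_slit_source hp hps] with q hq v w b c hv hw
    rw [sasaki_eq hF he hq.1 hq.2, hv, hw]
    simp [vpart_apply]
  bracket := by
    intro a b ha hb
    rw [fderiv_inr (ha.differentiableAt (by simp)), fderiv_inr (hb.differentiableAt (by simp)),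
      map_sub, vpart_vert, vpart_vert]

lemma contDiffAt_hliftL (hF : IsFinsler F)
    (he : e ∈ IsManifold.maximalAtlas 𝓘(ℝ, Coord n) ∞ N) (hp : p.1 ∈ e.source)
    (hps : p ∈ slit n N) : ContDiffAt ℝ ∞ (hliftL (sprayVec F e)) (coords e p) := by
  have h : hliftL (sprayVec F e) = fun z => ContinuousLinearMap.inl ℝ _ _ -
      (ContinuousLinearMap.inr ℝ _ _).comp (nonlin (sprayVec F e) z) := by
    ext z v <;> simp [hliftL]
  rw [h]
  exact contDiffAt_const.sub (contDiffAt_const.clm_comp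
    ((isSprayOn_target hF he).contDiffAt_nonlin (coords_mem_slitOver he hp hps)))

/-- The first component of a lift is the lifted vector itself. Hence the curvature of `N`, which is
vertical, does not enter the projected bracket. -/
lemma isAdaptedFrame_hor (hF : IsFinsler F)
    (he : e ∈ IsManifold.maximalAtlas 𝓘(ℝ, Coord n) ∞ N) (hp : p.1 ∈ e.source)
    (hps : p ∈ slit n N) :
    IsAdaptedFrame F e p (horP F) (hliftL (sprayVec F e))
      (fun _ => ContinuousLinearMap.fst ℝ _ _) where
  smooth_lift := contDiffAt_hliftL hF he hp hps
  smooth_comp := contDiffAt_const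
  comp_lift := fun v => rfl
  proj := by
    filter_upwards [eventually_slit_source hp hps] with q hq v using dcoords_horP hF he hq.1 hq.2 v
  metric := by
    filter_upwards [eventually_slit_source hp hps] with q hq v w b c hv hw
    rw [sasaki_eq hF he hq.1 hq.2, hv, hw, hliftL_apply, hliftL_apply, vpart_hlift, map_zero,
      _root_.zero_apply, add_zero]
    rfl
  bracket := by
    intro a b ha hb
    have h : ∀ a : Coord n × Coord n → Coord n, ContDiffAt ℝ ∞ a (coords e p) → ∀ D,
        (fderiv ℝ (fun w => hliftL (sprayVec F e) w (a w)) (coords e p) D).1 =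
          fderiv ℝ a (coords e p) D := by
      intro a ha D
      have h1 : DifferentiableAt ℝ (fun w => hliftL (sprayVec F e) w (a w)) (coords e p) :=
        ((contDiffAt_hliftL hF he hp hps).clm_apply ha).differentiableAt (by simp)
      exact (DFunLike.congr_fun ((ContinuousLinearMap.fst ℝ (Coord n) (Coord n)).hasFDerivAt.comp _
        h1.hasFDerivAt).fderiv D).symm
    exact congrArg₂ (· - ·) (h b hb _) (h a ha _)

/-- A smooth vector field with a given value at `p`. -/
lemma exists_smoothFieldAt (he : e ∈ IsManifold.maximalAtlas 𝓘(ℝ, Coord n) ∞ N)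
    (hp : p.1 ∈ e.source) (v : TangentSpace (TI n) p) :
    ∃ Z : Π q : TB n N, TangentSpace (TI n) q, SubWeyl.SmoothFieldAt (TI n) Z p ∧ Z p = v := by
  refine ⟨VectorField.mpullback (TI n) 𝓘(ℝ, Coord n × Coord n) (coords e)
    (fun _ => dcoords e p v), ?_, ?_⟩
  · exact ContMDiffAt.mpullback_vectorField_preimage
      (contMDiffAt_vectorSpace_iff_contDiffAt.2 contDiffAt_const) (contMDiffAt_coords he hp)
      (dcoords_isInvertible he hp) le_rfl
  · exact ContinuousLinearMap.IsInvertible.inverse_apply_self (dcoords_isInvertible he hp) v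

/-! ### The Koszul formula in an adapted frame -/

namespace IsAdaptedFrame

variable {Q Q' : Π q : TB n N, TangentSpace (TI n) q →L[ℝ] TangentSpace (TI n) q}
  {lift : Coord n × Coord n → Coord n →L[ℝ] Coord n × Coord n}
  {comp : Coord n × Coord n → Coord n × Coord n →L[ℝ] Coord n}
  {β : Π q : TB n N, TangentSpace (TI n) q →L[ℝ] ℝ}
  {X Y : Π q : TB n N, TangentSpace (TI n) q} {a b : Coord n × Coord n → Coord n}

lemma represents (h : IsAdaptedFrame F e p Q lift comp)
    {A : Coord n × Coord n → Coord n × Coord n} (hX : Represents e p X A) :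
    Represents e p (fun q => Q q (X q)) (fun z => lift z (comp z (A z))) := by
  filter_upwards [hX, h.proj] with q h1 h2
  rw [h2, h1]

lemma koszul_eq (h : IsAdaptedFrame F e p Q lift comp) (hF : IsFinsler F)
    (he : e ∈ IsManifold.maximalAtlas 𝓘(ℝ, Coord n) ∞ N) (hp : p.1 ∈ e.source)
    (hps : p ∈ slit n N) {A B C : Π q : TB n N, TangentSpace (TI n) q}
    {a b c : Coord n × Coord n → Coord n} (hA : Represents e p A fun z => lift z (a z))
    (hB : Represents e p B fun z => lift z (b z)) (hC : Represents e p C fun z => lift z (c z))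
    (ha : ContDiffAt ℝ ∞ a (coords e p)) (hb : ContDiffAt ℝ ∞ b (coords e p))
    (hc : ContDiffAt ℝ ∞ c (coords e p)) {z : Coord n × Coord n} (hz : z = coords e p) :
    SubWeyl.koszul (TI n) (sasaki F) β Q A B C p =
      fderiv ℝ (fibreMetric (sqF F e)) z (lift z (a z)) (b z) (c z)
      + fderiv ℝ (fibreMetric (sqF F e)) z (lift z (b z)) (c z) (a z)
      - fderiv ℝ (fibreMetric (sqF F e)) z (lift z (c z)) (a z) (b z)
      + 2 * fibreMetric (sqF F e) z (fderiv ℝ b z (lift z (a z))) (c z)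
      + β p (A p) * fibreMetric (sqF F e) z (b z) (c z)
      + β p (B p) * fibreMetric (sqF F e) z (c z) (a z)
      - β p (C p) * fibreMetric (sqF F e) z (a z) (b z) := by
  subst hz
  have hzs := coords_mem_slitOver he hp hps
  have hS := isSprayOn_target hF he
  have hg := hS.differentiableAt_fibreMetric hzs
  have hm := h.metric.self_of_nhds
  have hd : ∀ {A B C : Π q : TB n N, TangentSpace (TI n) q}
      {a b c : Coord n × Coord n → Coord n}, (Represents e p A fun z => lift z (a z)) →
      (Represents e p B fun z => lift z (b z)) → (Represents e p C fun z => lift z (c z)) →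
      ContDiffAt ℝ ∞ b (coords e p) → ContDiffAt ℝ ∞ c (coords e p) →
      SubWeyl.dirDeriv (TI n) A (fun q => sasaki F q (B q) (C q)) p =
        fderiv ℝ (fun w => fibreMetric (sqF F e) w (b w) (c w)) (coords e p)
          (lift (coords e p) (a (coords e p))) := by
    intro A B C a b c hA hB hC hb hc
    rw [dirDeriv_eq he hp (k := fun w => fibreMetric (sqF F e) w (b w) (c w)), hA.eq]
    · filter_upwards [h.metric, hB, hC] with q h1 h2 h3 using h1 _ _ _ _ h2 h3
    · exact (hg.clm_apply (hb.differentiableAt (by simp))).clm_apply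
        (hc.differentiableAt (by simp))
  have hbr : ∀ {A B C : Π q : TB n N, TangentSpace (TI n) q}
      {a b c : Coord n × Coord n → Coord n}, (Represents e p A fun z => lift z (a z)) →
      (Represents e p B fun z => lift z (b z)) → (Represents e p C fun z => lift z (c z)) →
      ContDiffAt ℝ ∞ a (coords e p) → ContDiffAt ℝ ∞ b (coords e p) →
      sasaki F p (Q p (VectorField.mlieBracket (TI n) A B p)) (C p) =
        fibreMetric (sqF F e) (coords e p)
          (fderiv ℝ b (coords e p) (lift (coords e p) (a (coords e p)))
            - fderiv ℝ a (coords e p) (lift (coords e p) (b (coords e p)))) (c (coords e p)) := by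
    intro A B C a b c hA hB hC ha hb
    refine hm _ _ _ _ ?_ hC.eq
    rw [h.proj.self_of_nhds, Represents.mlieBracket he hp hA hB (h.smooth_lift.clm_apply ha)
      (h.smooth_lift.clm_apply hb), h.bracket a b ha hb]
  have hk := koszul_trivial (lift (coords e p) (a (coords e p)))
    (lift (coords e p) (b (coords e p))) (lift (coords e p) (c (coords e p))) hg
    (hS.fibreMetric_symm hzs) (ha.differentiableAt (by simp)) (hb.differentiableAt (by simp))
    (hc.differentiableAt (by simp))
  unfold SubWeyl.koszul
  rw [hd hA hB hC hb hc, hd hB hC hA hc ha, hd hC hA hB ha hb, hbr hA hB hC ha hb,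
    hbr hB hC hA hb hc, hbr hC hA hB hc ha, hm _ _ _ _ hB.eq hC.eq, hm _ _ _ _ hC.eq hA.eq,
    hm _ _ _ _ hA.eq hB.eq]
  rw [hk]

/-- Positive definiteness, tested on a smooth field with value `w - w'` at `p`. -/
lemma koszulDeriv_unique (h : IsAdaptedFrame F e p Q lift comp) (hF : IsFinsler F)
    (he : e ∈ IsManifold.maximalAtlas 𝓘(ℝ, Coord n) ∞ N) (hp : p.1 ∈ e.source)
    (hps : p ∈ slit n N) {w w' : TangentSpace (TI n) p}
    (hw : SubWeyl.IsKoszulDerivAt (TI n) (sasaki F) β Q X Y p w)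
    (hw' : SubWeyl.IsKoszulDerivAt (TI n) (sasaki F) β Q X Y p w') : w = w' := by
  have hzs := coords_mem_slitOver he hp hps
  have hS := isSprayOn_target hF he
  have hpr := h.proj.self_of_nhds
  have hm := h.metric.self_of_nhds
  have hd : ∀ {w : TangentSpace (TI n) p}, Q p w = w →
      dcoords e p w = lift (coords e p) (comp (coords e p) (dcoords e p w)) := by
    intro w hw
    conv_lhs => rw [← hw]
    exact hpr w
  have hQ : Q p (w - w') = w - w' := by rw [map_sub, hw.1, hw'.1]
  obtain ⟨Z, hZ, hZp⟩ := exists_smoothFieldAt he hp (w - w')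
  have h1 := (hw.2 Z hZ).trans (hw'.2 Z hZ).symm
  rw [hZp, hQ, hm _ _ _ _ (hd hw.1) (hd hQ), hm _ _ _ _ (hd hw'.1) (hd hQ)] at h1
  have h2 : comp (coords e p) (dcoords e p (w - w')) = 0 := by
    by_contra hne
    have h3 := hS.pos _ hzs _ hne
    have h4 : fibreMetric (sqF F e) (coords e p) (comp (coords e p) (dcoords e p (w - w')))
        (comp (coords e p) (dcoords e p (w - w'))) = 0 := by
      conv_lhs =>
        enter [1]
        rw [map_sub, map_sub, map_sub]
      rw [sub_apply]
      linarith
    rw [fibreMetric_apply] at h4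
    linarith
  have h5 := hd hQ
  rw [h2, map_zero] at h5
  exact sub_eq_zero.1 (dcoords_injective he hp (h5.trans (map_zero _).symm))

/-- The intrinsic Weyl connection in an adapted frame. -/
lemma dcoords_intrinsicWeyl (h : IsAdaptedFrame F e p Q lift comp) (hF : IsFinsler F)
    (he : e ∈ IsManifold.maximalAtlas 𝓘(ℝ, Coord n) ∞ N) (hp : p.1 ∈ e.source)
    (hps : p ∈ slit n N) (hX : Represents e p (fun q => Q q (X q)) fun z => lift z (a z))
    (hY : Represents e p (fun q => Q q (Y q)) fun z => lift z (b z))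
    (ha : ContDiffAt ℝ ∞ a (coords e p)) (hb : ContDiffAt ℝ ∞ b (coords e p)) (u : Coord n)
    {z : Coord n × Coord n} (hz : z = coords e p)
    {θ : Coord n → ℝ} (hθ : ∀ v, θ v = β p ((dcoords e p).inverse (lift z v)))
    (hu : ∀ c : Coord n, 2 * fibreMetric (sqF F e) z u c =
      fderiv ℝ (fibreMetric (sqF F e)) z (lift z (a z)) (b z) c
      + fderiv ℝ (fibreMetric (sqF F e)) z (lift z (b z)) c (a z)
      - fderiv ℝ (fibreMetric (sqF F e)) z (lift z c) (a z) (b z)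
      + 2 * fibreMetric (sqF F e) z (fderiv ℝ b z (lift z (a z))) c
      + θ (a z) * fibreMetric (sqF F e) z (b z) c
      + θ (b z) * fibreMetric (sqF F e) z c (a z)
      - θ c * fibreMetric (sqF F e) z (a z) (b z)) :
    dcoords e p (SubWeyl.intrinsicWeyl (TI n) (sasaki F) β Q Q' X Y p) = lift z u +
      dcoords e p (Q p (VectorField.mlieBracket (TI n) (fun q => Q' q (X q))
        (fun q => Q q (Y q)) p)) := by
  subst hz
  set w := (dcoords e p).inverse (lift (coords e p) u) with hwdef
  have hdw : dcoords e p w = lift (coords e p) u := dcoords_inverse he hp _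
  have hθ' : ∀ (t : TangentSpace (TI n) p) (v : Coord n), dcoords e p t = lift (coords e p) v →
      β p t = θ v := by
    intro t v ht
    rw [hθ, ← ht, ContinuousLinearMap.IsInvertible.inverse_apply_self (dcoords_isInvertible he hp)]
  have hw : SubWeyl.IsKoszulDerivAt (TI n) (sasaki F) β Q X Y p w := by
    refine ⟨dcoords_injective he hp ?_, fun Z hZ => ?_⟩
    · rw [h.proj.self_of_nhds, hdw, h.comp_lift]
    · obtain ⟨C, hC, hZC⟩ := exists_represents he hp hZ
      have hQZ := h.represents hZC
      have hc := h.smooth_comp.clm_apply hC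
      rw [h.koszul_eq hF he hp hps hX hY hQZ ha hb hc rfl, hθ' _ _ hX.eq, hθ' _ _ hY.eq,
        hθ' _ _ hQZ.eq, h.metric.self_of_nhds _ _ _ _ hdw hQZ.eq]
      exact hu _
  -- The connection is defined by choice: existence through `w` together with uniqueness identifies
  -- the chosen vector.
  have heps : Classical.epsilon
      (fun w => SubWeyl.IsKoszulDerivAt (TI n) (sasaki F) β Q X Y p w) = w :=
    h.koszulDeriv_unique hF he hp hps (Classical.epsilon_spec ⟨w, hw⟩) hw
  unfold SubWeyl.intrinsicWeyl
  rw [heps, map_add, hdw]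

/-- The intrinsic Weyl connection vanishes on sections that vanish near `p`. -/
lemma intrinsicWeyl_eq_zero (h : IsAdaptedFrame F e p Q lift comp) (hF : IsFinsler F)
    (he : e ∈ IsManifold.maximalAtlas 𝓘(ℝ, Coord n) ∞ N) (hp : p.1 ∈ e.source)
    (hps : p ∈ slit n N) (hX : SubWeyl.SmoothFieldAt (TI n) X p)
    (hY : ∀ᶠ q in 𝓝 p, Q q (Y q) = 0) :
    SubWeyl.intrinsicWeyl (TI n) (sasaki F) β Q Q' X Y p = 0 := by
  obtain ⟨A, hA, hXA⟩ := exists_represents he hp hX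
  apply dcoords_injective he hp
  rw [h.dcoords_intrinsicWeyl (b := fun _ => 0) hF he hp hps (h.represents hXA) ?_
    (h.smooth_comp.clm_apply hA) contDiffAt_const 0 rfl (fun v => rfl) ?_,
    mlieBracket_eq_zero_of_right hY]
  · simp
  · filter_upwards [hY] with q hq
    rw [hq, map_zero, map_zero]
  · intro c
    simp

end IsAdaptedFrame

end Connections

/-! ## The Vranceanu derivatives of the Liouville field and of the geodesic spray -/

section Vranceanu

variable {n : ℕ} {N : Type*} [TopologicalSpace N] [ChartedSpace (Coord n) N]
  [IsManifold 𝓘(ℝ, Coord n) ∞ N]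

variable {F : TB n N → ℝ} {e : OpenPartialHomeomorph N (Coord n)} {p : TB n N}
  {X : Π q : TB n N, TangentSpace (TI n) q}
  {W : (Π p : TB n N, TangentSpace (TI n) p → TangentSpace (TI n) p → ℝ) →
      Π p : TB n N, TangentSpace (TI n) p →L[ℝ] ℝ}

lemma fderiv_hliftL {G h : Coord n × Coord n → Coord n} {z : Coord n × Coord n}
    (hG : DifferentiableAt ℝ (nonlin G) z) (hh : DifferentiableAt ℝ h z) (D : Coord n × Coord n) :
    fderiv ℝ (fun w => hliftL G w (h w)) z D = (fderiv ℝ h z D,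
      -(fderiv ℝ (nonlin G) z D (h z) + nonlin G z (fderiv ℝ h z D))) := by
  have h1 := hh.hasFDerivAt.prodMk (hG.hasFDerivAt.clm_apply hh.hasFDerivAt).neg
  refine (DFunLike.congr_fun h1.fderiv D).trans ?_
  simp [add_comm]

lemma dcoords_nablaStar_liouville (hF : IsFinsler F)
    (he : e ∈ IsManifold.maximalAtlas 𝓘(ℝ, Coord n) ∞ N) (hp : p.1 ∈ e.source)
    (hps : p ∈ slit n N) (hX : SubWeyl.SmoothFieldAt (TI n) X p)
    {z a : Coord n × Coord n} (hz : z = coords e p) (ha : a = dcoords e p (X p))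
    {θ : Coord n → ℝ} (hθ : ∀ v, θ v = W (sasaki F) p ((dcoords e p).inverse (0, v)))
    {θup : Coord n} (hθup : ∀ c, fibreMetric (sqF F e) z θup c = θ c) :
    dcoords e p (nablaStar F W X liouville p) =
      (0, vpart (sprayVec F e) z a + (1 / 2 : ℝ) • (θ (vpart (sprayVec F e) z a) • z.2
        + θ z.2 • vpart (sprayVec F e) z a
        - fibreMetric (sqF F e) z (vpart (sprayVec F e) z a) z.2 • θup)) := by
  subst hz ha
  have hzs := coords_mem_slitOver he hp hps
  have hS := isSprayOn_target hF he
  have hN := hS.differentiableAt_nonlin hzs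
  have hev := eventually_slit_source (e := e) hp hps
  have fV := isAdaptedFrame_vert hF he hp hps
  have fH := isAdaptedFrame_hor hF he hp hps
  obtain ⟨A, hA, hXA⟩ := exists_represents he hp hX
  have haV := fV.smooth_comp.clm_apply hA
  have haH := fH.smooth_comp.clm_apply hA
  have hL : Represents e p (fun q => vertP F q (liouville q))
      (fun w => ContinuousLinearMap.inr ℝ (Coord n) (Coord n) w.2) := by
    filter_upwards [hev] with q hq
    rw [dcoords_vertP hF he hq.1 hq.2, dcoords_liouville hF he hq.1 hq.2, vpart_vert]
    rfl
  have hL0 : ∀ᶠ q : TB n N in 𝓝 p, horP F q (liouville q) = 0 := by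
    filter_upwards [hev] with q hq
    apply dcoords_injective he hq.1
    rw [dcoords_horP hF he hq.1 hq.2, dcoords_liouville hF he hq.1 hq.2, map_zero]
    simp [hlift]
  have hsnd : ∀ D, fderiv ℝ (fun w : Coord n × Coord n => w.2) (coords e p) D = D.2 := by
    intro D
    rw [fderiv_snd]; rfl
  have hbr : dcoords e p (vertP F p (VectorField.mlieBracket (TI n)
      (fun q => horP F q (X q)) (fun q => vertP F q (liouville q)) p)) = 0 := by
    rw [dcoords_vertP hF he hp hps, Represents.mlieBracket he hp (fH.represents hXA) hL
      (fH.smooth_lift.clm_apply haH) (contDiffAt_const.clm_apply contDiffAt_snd),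
      fderiv_inr differentiableAt_snd, fderiv_hliftL hN (haH.differentiableAt (by simp)),
      hsnd]
    -- Differentiating `-N` along `L` cancels the term `-N h` that arises from `y` along the lift of
    -- `h`.
    have h1 := hS.fderiv_nonlin_vert hzs
    simp only [ContinuousLinearMap.inr_apply, h1, vpart_apply, hliftL_apply, hlift]
    simp
  unfold nablaStar SubWeyl.vranceanu
  rw [fH.intrinsicWeyl_eq_zero hF he hp hps hX hL0, add_zero,
    fV.dcoords_intrinsicWeyl hF he hp hps (fV.represents hXA) hL haV contDiffAt_snd
      (vpart (sprayVec F e) (coords e p) (dcoords e p (X p)) + (1 / 2 : ℝ) •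
        (θ (vpart (sprayVec F e) (coords e p) (dcoords e p (X p))) • (coords e p).2
        + θ (coords e p).2 • vpart (sprayVec F e) (coords e p) (dcoords e p (X p))
        - fibreMetric (sqF F e) (coords e p)
          (vpart (sprayVec F e) (coords e p) (dcoords e p (X p))) (coords e p).2 • θup))
      rfl hθ ?_, hbr, add_zero]
  · rfl
  · intro c
    rw [← hXA.eq, hsnd]
    set v := vpart (sprayVec F e) (coords e p) (dcoords e p (X p))
    -- The Cartan tensor vanishes as soon as one of its three slots contains `y`.
    have t1 : ∀ q c, third (sqF F e) (coords e p) (0, q) (0, c) (0, (coords e p).2) = 0 := by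
      intro q c
      rw [hS.third_vert_vert hzs, hS.hess_symm hzs]
      simp
    have t2 : ∀ q c, third (sqF F e) (coords e p) (0, q) (0, (coords e p).2) (0, c) = 0 := by
      intro q c
      rw [hS.third_symm_right hzs, t1]
    have t3 : ∀ q c, third (sqF F e) (coords e p) (0, (coords e p).2) (0, q) (0, c) = 0 := by
      intro q c
      rw [hS.third_symm_left hzs, t2]
    simp only [hS.fderiv_fibreMetric hzs, ContinuousLinearMap.inr_apply, t1, t2, t3, map_add,
      map_sub, map_smul, add_apply, sub_apply, smul_apply, smul_eq_mul, hθup]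
    rw [hS.fibreMetric_symm hzs c v]
    ring

lemma dcoords_nablaStar_geoSpray (hF : IsFinsler F)
    (he : e ∈ IsManifold.maximalAtlas 𝓘(ℝ, Coord n) ∞ N) (hp : p.1 ∈ e.source)
    (hps : p ∈ slit n N) (hX : SubWeyl.SmoothFieldAt (TI n) X p)
    {z a : Coord n × Coord n} (hz : z = coords e p) (ha : a = dcoords e p (X p))
    {ρ : Coord n → ℝ} (hρ : ∀ v, ρ v =
      W (sasaki F) p ((dcoords e p).inverse (hlift (sprayVec F e) z v)))
    {ρup : Coord n} (hρup : ∀ c, fibreMetric (sqF F e) z ρup c = ρ c) :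
    dcoords e p (nablaStar F W X (geoSpray F) p) =
      hlift (sprayVec F e) z (vpart (sprayVec F e) z a + (1 / 2 : ℝ) • (ρ a.1 • z.2
        + ρ z.2 • a.1 - fibreMetric (sqF F e) z a.1 z.2 • ρup)) := by
  subst hz ha
  have hzs := coords_mem_slitOver he hp hps
  have hS := isSprayOn_target hF he
  have hN := hS.differentiableAt_nonlin hzs
  have hev := eventually_slit_source (e := e) hp hps
  have fV := isAdaptedFrame_vert hF he hp hps
  have fH := isAdaptedFrame_hor hF he hp hps
  obtain ⟨A, hA, hXA⟩ := exists_represents he hp hX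
  have haV := fV.smooth_comp.clm_apply hA
  have haH := fH.smooth_comp.clm_apply hA
  have hL : Represents e p (fun q => horP F q (geoSpray F q))
      (fun w => hliftL (sprayVec F e) w w.2) := by
    filter_upwards [hev] with q hq
    rw [dcoords_horP hF he hq.1 hq.2, dcoords_geoSpray hF he hq.1 hq.2]
    rfl
  have hL0 : ∀ᶠ q : TB n N in 𝓝 p, vertP F q (geoSpray F q) = 0 := by
    filter_upwards [hev] with q hq
    apply dcoords_injective he hq.1
    rw [dcoords_vertP hF he hq.1 hq.2, dcoords_geoSpray hF he hq.1 hq.2, map_zero, vpart_hlift]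
    rfl
  have hsnd : ∀ D, fderiv ℝ (fun w : Coord n × Coord n => w.2) (coords e p) D = D.2 := by
    intro D
    rw [fderiv_snd]; rfl
  have hbr : dcoords e p (horP F p (VectorField.mlieBracket (TI n)
      (fun q => vertP F q (X q)) (fun q => horP F q (geoSpray F q)) p)) =
      hliftL (sprayVec F e) (coords e p)
        (vpart (sprayVec F e) (coords e p) (dcoords e p (X p))) := by
    rw [dcoords_horP hF he hp hps, Represents.mlieBracket he hp (fV.represents hXA) hL
      (fV.smooth_lift.clm_apply haV) (fH.smooth_lift.clm_apply contDiffAt_snd),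
      fderiv_inr (haV.differentiableAt (by simp)), fderiv_hliftL hN differentiableAt_snd,
      hsnd, ← hXA.eq]
    -- In the base component only the derivative of `y` along the vertical part of `X` remains.
    simp [hliftL_apply]
  unfold nablaStar SubWeyl.vranceanu
  rw [fV.intrinsicWeyl_eq_zero hF he hp hps hX hL0, zero_add,
    fH.dcoords_intrinsicWeyl hF he hp hps (fH.represents hXA) hL haH contDiffAt_snd
      -- Only Weyl terms appear here: the vertical components of `X` in the result come entirely
      -- from the bracket `hbr`.
      ((1 / 2 : ℝ) • (ρ (dcoords e p (X p)).1 • (coords e p).2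
        + ρ (coords e p).2 • (dcoords e p (X p)).1
        - fibreMetric (sqF F e) (coords e p) (dcoords e p (X p)).1 (coords e p).2 • ρup))
      rfl hρ ?_, hbr, ← map_add, add_comm]
  · rfl
  · intro c
    rw [← hXA.eq, hsnd]
    simp only [ContinuousLinearMap.coe_fst']
    set v := (dcoords e p (X p)).1
    have h1 := hS.third_hlift hzs v c
    simp only [hS.fderiv_fibreMetric hzs, hliftL_apply, map_add,
      map_sub, map_smul, add_apply, sub_apply, smul_apply, smul_eq_mul, hρup]
    rw [hS.fibreMetric_symm hzs c v]
    -- The derivative of `y` along the lift of `v` is `-N v`; its contribution is opposite to that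
    -- of `h1`.
    have h2 : fibreMetric (sqF F e) (coords e p)
        (hlift (sprayVec F e) (coords e p) v).2 c =
        -(1 / 2 * hess (sqF F e) (coords e p) (0, nonlin (sprayVec F e) (coords e p) v) (0, c)) := by
      rw [← fibreMetric_apply]
      simp [hlift]
    rw [h2]
    linarith

/-! ### Components -/

lemma fibreMetric_raise (hF : IsFinsler F)
    (he : e ∈ IsManifold.maximalAtlas 𝓘(ℝ, Coord n) ∞ N) {z : Coord n × Coord n}
    (hz : z ∈ slitOver e.target) {θ θup : Fin n → ℝ}
    (h : ∀ i, θup i = ∑ j, (gMat F e z)⁻¹ i j * θ j) (c : Coord n) :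
    fibreMetric (sqF F e) z (WithLp.toLp 2 θup) c = ∑ i, c i * θ i := by
  have h0 : θup = Matrix.mulVec (gMat F e z)⁻¹ θ := funext h
  have h1 : Matrix.mulVec (gMat F e z) θup = θ := by
    rw [h0, Matrix.mulVec_mulVec, Matrix.mul_nonsing_inv, Matrix.one_mulVec]
    exact (posDef_gMat hF he hz).det_pos.ne'.isUnit
  rw [(isSprayOn_target hF he).fibreMetric_symm hz, fibreMetric_eq_sum hF he hz]
  refine Finset.sum_congr rfl fun i _ => ?_
  rw [← congrFun h1 i, Matrix.mulVec, dotProduct, Finset.mul_sum]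
  exact Finset.sum_congr rfl fun j _ => by ring

/-- Evaluating the Kronecker deltas matches the index formula with the invariant one. -/
lemma sum_contract (a y θ : Fin n → ℝ) (g : Matrix (Fin n) (Fin n) ℝ) (t : ℝ) (i : Fin n) :
    ∑ j, ∑ k, a j * y k * (θ j * (if k = i then 1 else 0) + θ k * (if j = i then 1 else 0)
      - t * g j k) = (∑ j, a j * θ j) * y i + (∑ k, y k * θ k) * a i
      - (∑ j, ∑ k, g j k * (a j * y k)) * t := by
  have h1 : ∀ j, ∑ k, a j * y k * (θ j * (if k = i then 1 else 0)
      + θ k * (if j = i then 1 else 0) - t * g j k) = a j * θ j * y i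
      + (if j = i then 1 else 0) * (a j * ∑ k, y k * θ k) - t * ∑ k, g j k * (a j * y k) := by
    intro j
    simp only [mul_sub, mul_add, Finset.sum_sub_distrib, Finset.sum_add_distrib, Finset.mul_sum]
    refine congrArg₂ _ (congrArg₂ _ ?_ ?_) ?_
    · simp [mul_comm, mul_left_comm]
    · exact Finset.sum_congr rfl fun k _ => by ring
    · exact Finset.sum_congr rfl fun k _ => by ring
  simp only [h1, Finset.sum_sub_distrib, Finset.sum_add_distrib, ← Finset.sum_mul,
    ← Finset.mul_sum]
  simp
  ring

lemma nablaStar_liouville_components (hF : IsFinsler F)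
    (he : e ∈ IsManifold.maximalAtlas 𝓘(ℝ, Coord n) ∞ N) (hp : p.1 ∈ e.source)
    (hps : p ∈ slit n N) (hX : SubWeyl.SmoothFieldAt (TI n) X p)
    {y Xv θ θup : Fin n → ℝ} (hy : ∀ i, y i = (coords e p).2 i)
    (hXv : ∀ i, Xv i = deltaY F e i p (X p)) (hθ : ∀ i, θ i = W (sasaki F) p (dDy e i p))
    (hθup : ∀ i, θup i = ∑ j, (gMat F e (coords e p))⁻¹ i j * θ j) :
    nablaStar F W X liouville p = ∑ i, (Xv i + 1 / 2 * ∑ j, ∑ k, Xv j * y k *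
      (θ j * (if k = i then 1 else 0) + θ k * (if j = i then 1 else 0)
        - θup i * gMat F e (coords e p) j k)) • dDy e i p := by
  have hzs := coords_mem_slitOver he hp hps
  apply dcoords_injective he hp
  have hΘ : ∀ v : Coord n, ∑ i, v i * θ i = W (sasaki F) p ((dcoords e p).inverse (0, v)) := by
    intro v
    have h1 : (dcoords e p).inverse (0, v) = ∑ i, v i • dDy e i p := by
      apply dcoords_injective he hp
      rw [dcoords_inverse he hp, dcoords_sum_dDy he hp fun i => v i]
    rw [h1, map_sum]
    simp only [map_smul, smul_eq_mul, hθ]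
  rw [dcoords_nablaStar_liouville hF he hp hps hX rfl rfl hΘ (fibreMetric_raise hF he hzs hθup),
    dcoords_sum_dDy he hp]
  refine congrArg _ ?_
  ext i
  have hv : ∀ j, vpart (sprayVec F e) (coords e p) (dcoords e p (X p)) j = Xv j :=
    fun j => by rw [hXv, deltaY_apply hF he hp hps]
  simp only [PiLp.add_apply, PiLp.sub_apply, PiLp.smul_apply, smul_eq_mul, sum_contract,
    fibreMetric_eq_sum hF he hzs, hv, ← hy]

lemma nablaStar_geoSpray_components (hF : IsFinsler F)
    (he : e ∈ IsManifold.maximalAtlas 𝓘(ℝ, Coord n) ∞ N) (hp : p.1 ∈ e.source)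
    (hps : p ∈ slit n N) (hX : SubWeyl.SmoothFieldAt (TI n) X p)
    {y Xv Xh ρ ρup : Fin n → ℝ} (hy : ∀ i, y i = (coords e p).2 i)
    (hXv : ∀ i, Xv i = deltaY F e i p (X p)) (hXh : ∀ a, Xh a = dx e a p (X p))
    (hρ : ∀ a, ρ a = W (sasaki F) p (deltaX F e a p))
    (hρup : ∀ i, ρup i = ∑ j, (gMat F e (coords e p))⁻¹ i j * ρ j) :
    nablaStar F W X (geoSpray F) p = ∑ a, (Xv a + 1 / 2 * ∑ b, ∑ c, Xh b * y c *
      (ρ b * (if c = a then 1 else 0) + ρ c * (if b = a then 1 else 0)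
        - ρup a * gMat F e (coords e p) b c)) • deltaX F e a p := by
  have hzs := coords_mem_slitOver he hp hps
  apply dcoords_injective he hp
  have hΡ : ∀ v : Coord n, ∑ i, v i * ρ i =
      W (sasaki F) p ((dcoords e p).inverse (hlift (sprayVec F e) (coords e p) v)) := by
    intro v
    have h1 : (dcoords e p).inverse (hlift (sprayVec F e) (coords e p) v) =
        ∑ i, v i • deltaX F e i p := by
      apply dcoords_injective he hp
      rw [dcoords_inverse he hp, dcoords_sum_deltaX hF he hp hps fun i => v i]
    rw [h1, map_sum]
    simp only [map_smul, smul_eq_mul, hρ]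
  rw [dcoords_nablaStar_geoSpray hF he hp hps hX rfl rfl hΡ (fibreMetric_raise hF he hzs hρup),
    dcoords_sum_deltaX hF he hp hps]
  refine congrArg _ ?_
  ext i
  have hv : ∀ j, vpart (sprayVec F e) (coords e p) (dcoords e p (X p)) j = Xv j :=
    fun j => by rw [hXv, deltaY_apply hF he hp hps]
  have hh : ∀ j, (dcoords e p (X p)).1 j = Xh j := fun j => by rw [hXh, dx_apply]
  simp only [PiLp.add_apply, PiLp.sub_apply, PiLp.smul_apply, smul_eq_mul, sum_contract,
    fibreMetric_eq_sum hF he hzs, hv, hh, ← hy]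

/-! ### The Cartan form as Weyl one-form -/

lemma nablaStar_liouville_cartan (hF : IsFinsler F)
    (he : e ∈ IsManifold.maximalAtlas 𝓘(ℝ, Coord n) ∞ N) (hp : p.1 ∈ e.source)
    (hps : p ∈ slit n N) (hX : SubWeyl.SmoothFieldAt (TI n) X p)
    (hW : W (sasaki F) p = cartanForm F p) :
    nablaStar F W X liouville p = ∑ i, deltaY F e i p (X p) • dDy e i p := by
  apply dcoords_injective he hp
  -- The Cartan form annihilates vertical vectors.
  rw [dcoords_nablaStar_liouville (θ := fun _ => 0) (θup := 0) hF he hp hps hX rfl rfl ?_ ?_,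
    dcoords_sum_dDy he hp]
  · refine congrArg _ ?_
    ext i
    simp [deltaY_apply hF he hp hps]
  · intro v
    rw [hW, cartanForm_eq hF he hp hps, dcoords_inverse he hp, map_zero]
  · intro c
    simp

lemma nablaStar_geoSpray_cartan (hF : IsFinsler F)
    (he : e ∈ IsManifold.maximalAtlas 𝓘(ℝ, Coord n) ∞ N) (hp : p.1 ∈ e.source)
    (hps : p ∈ slit n N) (hX : SubWeyl.SmoothFieldAt (TI n) X p)
    (hW : W (sasaki F) p = cartanForm F p) :
    nablaStar F W X (geoSpray F) p = ∑ a, (deltaY F e a p (X p) + 1 / 2 * dx e a p (X p) *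
      fibreMetric (sqF F e) (coords e p) (coords e p).2 (coords e p).2) • deltaX F e a p := by
  have hzs := coords_mem_slitOver he hp hps
  apply dcoords_injective he hp
  rw [dcoords_nablaStar_geoSpray
    -- On horizontal lifts the Cartan form is `g(y, ·)`, so raising its index returns `y`. The terms
    -- `ρ(X) y` and `g(X, y) ρup` then agree and cancel.
    (ρ := fun v => fibreMetric (sqF F e) (coords e p) (coords e p).2 v) (ρup := (coords e p).2)
    hF he hp hps hX rfl rfl ?_ (fun c => rfl), dcoords_sum_deltaX hF he hp hps]
  · refine congrArg _ ?_
    ext i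
    rw [(isSprayOn_target hF he).fibreMetric_symm hzs (dcoords e p (X p)).1]
    simp only [PiLp.add_apply, PiLp.sub_apply, PiLp.smul_apply, smul_eq_mul, dx_apply,
      deltaY_apply hF he hp hps]
    ring
  · intro v
    rw [hW, cartanForm_eq hF he hp hps, dcoords_inverse he hp]
    rfl

end Vranceanu

end Finsler

end

theorem proposition3p13 {n : ℕ} {N : Type*} [TopologicalSpace N] [T2Space N]
    [SecondCountableTopology N] [ChartedSpace (Finsler.Coord n) N]
    [IsManifold 𝓘(ℝ, Finsler.Coord n) ∞ N]
    (F : Finsler.TB n N → ℝ) (hF : Finsler.IsFinsler F)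
    (W : (Π p : Finsler.TB n N, TangentSpace (Finsler.TI n) p →
        TangentSpace (Finsler.TI n) p → ℝ) →
      Π p : Finsler.TB n N, TangentSpace (Finsler.TI n) p →L[ℝ] ℝ)
    (hW : SubWeyl.IsWeylStructureOn (Finsler.TI n) (Finsler.sasaki F) W (Finsler.slit n N))
    (X : Π p : Finsler.TB n N, TangentSpace (Finsler.TI n) p)
    (hX : SubWeyl.SmoothFieldOn (Finsler.TI n) X (Finsler.slit n N)) :
    -- the general formulas, in the coordinates induced by any chart `e` of `N`
    (∀ e ∈ IsManifold.maximalAtlas 𝓘(ℝ, Finsler.Coord n) ∞ N,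
      ∀ p ∈ Finsler.slit n N, p.1 ∈ e.source →
      ∀ (y Xv Xh θ ρ θup ρup : Fin n → ℝ) (g : Matrix (Fin n) (Fin n) ℝ),
        (∀ i, y i = (Finsler.coords e p).2 i) →
        (∀ i, Xv i = Finsler.deltaY F e i p (X p)) →
        (∀ a, Xh a = Finsler.dx e a p (X p)) →
        (∀ i, θ i = W (Finsler.sasaki F) p (Finsler.dDy e i p)) →
        (∀ a, ρ a = W (Finsler.sasaki F) p (Finsler.deltaX F e a p)) →
        g = Finsler.gMat F e (Finsler.coords e p) →
        (∀ i, θup i = ∑ j, g⁻¹ i j * θ j) →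
        (∀ a, ρup a = ∑ b, g⁻¹ a b * ρ b) →
        Finsler.nablaStar F W X Finsler.liouville p =
          ∑ i, (Xv i + 1 / 2 * ∑ j, ∑ k, Xv j * y k *
            (θ j * (if k = i then 1 else 0) + θ k * (if j = i then 1 else 0) - θup i * g j k)) •
              Finsler.dDy e i p ∧
        Finsler.nablaStar F W X (Finsler.geoSpray F) p =
          ∑ a, (Xv a + 1 / 2 * ∑ b, ∑ c, Xh b * y c *
            (ρ b * (if c = a then 1 else 0) + ρ c * (if b = a then 1 else 0) - ρup a * g b c)) •
              Finsler.deltaX F e a p) ∧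
    -- the case `W(G) = θ_F`, in coordinates and globally
    ((∀ p ∈ Finsler.slit n N, W (Finsler.sasaki F) p = Finsler.cartanForm F p) →
      (∀ e ∈ IsManifold.maximalAtlas 𝓘(ℝ, Finsler.Coord n) ∞ N,
        ∀ p ∈ Finsler.slit n N, p.1 ∈ e.source →
          Finsler.nablaStar F W X Finsler.liouville p =
            ∑ i, Finsler.deltaY F e i p (X p) • Finsler.dDy e i p ∧
          Finsler.nablaStar F W X (Finsler.geoSpray F) p =
            ∑ a, (Finsler.deltaY F e a p (X p) + 1 / 2 * Finsler.dx e a p (X p) *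
              ∑ c, ∑ u, (Finsler.coords e p).2 c * (Finsler.coords e p).2 u *
                Finsler.gMat F e (Finsler.coords e p) u c) • Finsler.deltaX F e a p) ∧
      (∀ p ∈ Finsler.slit n N,
          Finsler.nablaStar F W X Finsler.liouville p = Finsler.vertP F p (X p) ∧
          Finsler.nablaStar F W X (Finsler.geoSpray F) p =
            Finsler.adjointStr F p (X p) + ((1 / 2 : ℝ) * F p ^ 2) • Finsler.horP F p (X p))) := by
  have hX' : ∀ p ∈ Finsler.slit n N, SubWeyl.SmoothFieldAt (Finsler.TI n) X p :=
    fun p hp => hX.contMDiffAt (Finsler.isOpen_slit.mem_nhds hp)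
  refine ⟨fun e he p hps hp y Xv Xh θ ρ θup ρup g hy hXv hXh hθ hρ hg hθup hρup => ?_,
    fun hC => ⟨fun e he p hps hp => ⟨?_, ?_⟩, fun p hps => ⟨?_, ?_⟩⟩⟩
  · subst hg
    exact ⟨Finsler.nablaStar_liouville_components hF he hp hps (hX' p hps) hy hXv hθ hθup,
      Finsler.nablaStar_geoSpray_components hF he hp hps (hX' p hps) hy hXv hXh hρ hρup⟩
  · exact Finsler.nablaStar_liouville_cartan hF he hp hps (hX' p hps) (hC p hps)
  · rw [Finsler.nablaStar_geoSpray_cartan hF he hp hps (hX' p hps) (hC p hps),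
      Finsler.fibreMetric_eq_sum hF he (Finsler.coords_mem_slitOver he hp hps), Finset.sum_comm]
    simp only [mul_comm]
  · rw [Finsler.vertP_eq_sum]
    -- The global formulas are the coordinate ones in the preferred chart at `p`, where `vertP`,
    -- `horP` and `adjointStr` are defined.
    exact Finsler.nablaStar_liouville_cartan hF (Finsler.pchart_mem p)
      (Finsler.mem_pchart_source p) hps (hX' p hps) (hC p hps)
  · rw [Finsler.nablaStar_geoSpray_cartan hF (Finsler.pchart_mem p)
      (Finsler.mem_pchart_source p) hps (hX' p hps) (hC p hps), Finsler.adjointStr_eq_sum,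
      Finsler.horP_eq_sum, Finset.smul_sum, ← Finset.sum_add_distrib,
      Finsler.sq_eq_fibreMetric hF (Finsler.pchart_mem p) (Finsler.mem_pchart_source p) hps]
    refine Finset.sum_congr rfl fun a _ => ?_
    rw [smul_smul, ← add_smul]
    congr 2
    ring
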